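/- Drones fly at a constant height $h$ over the plane, and a user stands at the origin on the ground. The points of the plane above which the drones are at time $0$ form a homogeneous Poisson point process with density $\lambda_0>0$, indexed by $i\in\mathbb N$. Each drone moves along a straight line with constant speed, in a direction that is uniformly distributed on $[0,2\pi)$; the speeds are i.i.d. and non-negative with probability density $f_V$ and distribution function $F_V$, the directions are i.i.d., and initial positions, speeds and directions are independent (the different speed model). Let $\mathbf x_i(s)$ be the position of drone $i$ at time $s$, and for $t>0$ let $$H(t)=\Big\{\exists\, s\in[0,t):\ \operatorname*{arg\,min}_{i\in\mathbb N}\|\mathbf x_i(s)\|\neq \operatorname*{arg\,min}_{i\in\mathbb N}\|\mathbf x_i(t)\|\Big\}$$ be the event that a handover occurs until time $t$ (the user is always served by the closest drone). Then $H(t)$ is an event (up to a null set), and $$\mathbb P[H(t)]\ \ge\ 1-\frac1{2\pi}\int_0^\infty\!\!\int_0^\infty\!\!\int_0^{2\pi}2\pi\lambda_0u^*e^{-\lambda_0\pi {u^*}^2}f_V(v)\exp\Big[-\int_0^R 2\pi u\,\lambda(t;u,u^*)\,du\Big]\,d\theta\,du^*\,dv,$$ where $R=\sqrt{{u^*}^2+v^2t^2-2u^*vt\cos\theta}$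 and $$\lambda(t;u,u^*)=\lambda_0\bigg[1-F_V\Big(\frac{u^*-u}{t}\Big)-\int_{|u^*-u|/t}^{(u^*+u)/t}f_V(v)\,\frac1\pi\cos^{-1}\Big(\frac{v^2t^2+u^2-{u^*}^2}{2vtu}\Big)dv\bigg].$$ -/

import Mathlib

open MeasureTheory ProbabilityTheory

/-- The number (in `ℕ∞`) of indices `i` for which the point `X i ω` lies in `B`. -/
noncomputable def pointCount {Ω E : Type*} (X : ℕ → Ω → E) (B : Set E) (ω : Ω) : ℕ∞ :=
  {i : ℕ | X i ω ∈ B}.encard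

/-- The random points `X 0, X 1, …`, indexed in some way, form a Poisson point process
with intensity measure `ν`: the number of points in a measurable set of finite intensity is Poisson
distributed, and the numbers of points in disjoint measurable sets are independent. -/
structure IsPoissonPointProcess {Ω E : Type*} [MeasurableSpace Ω] [MeasurableSpace E]
    (μ : Measure Ω) (X : ℕ → Ω → E) (ν : Measure E) : Prop where
  measurable : ∀ i, Measurable (X i)
  count_law : ∀ B : Set E, MeasurableSet B → ν B ≠ ⊤ → ∀ n : ℕ,
    μ {ω | pointCount X B ω = n} = poissonMeasure (ν B).toNNReal {n}
  count_indep : ∀ (k : ℕ) (B : Fin k → Set E), (∀ j, MeasurableSet (B j)) →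
    Pairwise (Function.onFun Disjoint B) → iIndepFun (fun j => pointCount X (B j)) μ

/-- The law of a real random variable with probability density function `f`. -/
noncomputable def densityLaw (f : ℝ → ℝ) : Measure ℝ :=
  volume.withDensity (fun v => ENNReal.ofReal (f v))

/-- The different speed model. Drone `i` starts above the point `X i` of the plane and
moves with constant speed `V i` in the constant direction `Θ i`. The starting points form a
homogeneous Poisson point process of density `lam0`; the speeds are i.i.d., non-negative, with
density `f`; the directions are i.i.d., uniform on `[0, 2π)`; starting points, speeds
and directions are independent. -/
structure IsDifferentSpeedModel {Ω : Type*} [MeasurableSpace Ω] (μ : Measure Ω)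
    (lam0 : ℝ) (f : ℝ → ℝ) (X : ℕ → Ω → EuclideanSpace ℝ (Fin 2)) (V Θ : ℕ → Ω → ℝ) :
    Prop where
  start_poisson : IsPoissonPointProcess μ X (ENNReal.ofReal lam0 • volume)
  speed_measurable : ∀ i, Measurable (V i)
  speed_nonneg : ∀ i, ∀ᵐ ω ∂μ, 0 ≤ V i ω
  speed_law : ∀ i, μ.map (V i) = densityLaw f
  direction_measurable : ∀ i, Measurable (Θ i)
  direction_law : ∀ i, pdf.IsUniform (Θ i) (Set.Ico 0 (2 * Real.pi)) μ volume
  speed_indep_direction : ∀ i, IndepFun (V i) (Θ i) μ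
  motion_indep : iIndepFun (fun i ω => (V i ω, Θ i ω)) μ
  start_indep_motion : IndepFun (fun ω i => X i ω) (fun ω i => (V i ω, Θ i ω)) μ

/-- The position in space at time `s` of a drone that flies at height `h`, starting above `x`, with
speed `v` in direction `θ`. -/
noncomputable def dronePosition (h : ℝ) (x : EuclideanSpace ℝ (Fin 2)) (v θ s : ℝ) :
    EuclideanSpace ℝ (Fin 3) :=
  !₂[x 0 + v * s * Real.cos θ, x 1 + v * s * Real.sin θ, h]

/-- The indices of the drones that are closest to the user at the origin at time `s`,
that is, the `arg min` over `i` of the distance of drone `i` from the origin. -/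
def servingDrone {Ω : Type*} (h : ℝ) (X : ℕ → Ω → EuclideanSpace ℝ (Fin 2)) (V Θ : ℕ → Ω → ℝ)
    (s : ℝ) (ω : Ω) : Set ℕ :=
  {i | ∀ j, ‖dronePosition h (X i ω) (V i ω) (Θ i ω) s‖ ≤
    ‖dronePosition h (X j ω) (V j ω) (Θ j ω) s‖}

/-- The event that at least one handover occurs until time `t`. -/
def handoverEvent {Ω : Type*} (h : ℝ) (X : ℕ → Ω → EuclideanSpace ℝ (Fin 2)) (V Θ : ℕ → Ω → ℝ)
    (t : ℝ) : Set Ω :=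
  {ω | ∃ s, 0 ≤ s ∧ s < t ∧ servingDrone h X V Θ s ω ≠ servingDrone h X V Θ t ω}

/-- The density `λ(t; u, u*)` at time `t`, at distance `u` from the projection of the
origin, of the drones that are initially not serving, when the initial distance of the serving
drone is `ustar`. -/
noncomputable def nonServingDensity (lam0 : ℝ) (f : ℝ → ℝ) (t u ustar : ℝ) : ℝ :=
  lam0 * (1 - cdf (densityLaw f) ((ustar - u) / t) -
    ∫ v in (|ustar - u| / t)..((ustar + u) / t),
      f v * (1 / Real.pi) *
        Real.arccos ((v ^ 2 * t ^ 2 + u ^ 2 - ustar ^ 2) / (2 * v * t * u)))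

/-- The distance `R` of the displaced initial serving drone from the projection of the origin. -/
noncomputable def displacedDistance (t ustar v θ : ℝ) : ℝ :=
  Real.sqrt (ustar ^ 2 + v ^ 2 * t ^ 2 - 2 * ustar * v * t * Real.cos θ)

open Filter Topology Set
open scoped ENNReal NNReal

/-! The bound comes from observing only the times `0` and `t`. Almost surely some drone is closest
at time `0`. If no handover occurs, the set of closest drones is the same at time `t`, so one drone
minimises both the initial distance `r` and the final distance `R`. It remains to bound the
probability of such a common minimiser.

Mark each starting point with its speed and direction. By
`IsPoissonPointProcess.measure_forall_notMem`, the marked points avoid a set `G` of finite intensity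
`N G` with probability `exp (-N G)`; this rests on the generating functional
`IsPoissonPointProcess.lintegral_iInf_prod`. These void probabilities alone give
`measure_exists_argmin_le`, a substitute for the Mecke formula: the probability of a common
minimiser is at most the integral over `z` of `exp (-N {r < r z or R < R z})` against `N`. Its proof
covers the space of marked points by small cells and sums over the cell that holds the minimiser.

The rest is computation. The set `{r < a or R < b}` splits into the disc of radius `a`, with
intensity `lam0 * π * a ^ 2`, and the drones that start outside it and end within `b`. Translation
invariance turns the intensity of the latter into an integral over final positions
(`markedIntensity_le_norm_finalDistance_lt`), whose radial density is identified with
`nonServingDensity` by the law of cosines (`nonServingDensity_eq`). Polar coordinates then give the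
triple integral. -/

/-! ### Exponentials of intensities, and powers with exponent in `ℕ∞`. -/

/-- The void probability `exp (-x)` of a set of intensity `x`, as an extended nonnegative real. -/
noncomputable def expNeg (x : ℝ≥0∞) : ℝ≥0∞ := ENNReal.ofReal (Real.exp (-x.toReal))

lemma expNeg_zero : expNeg 0 = 1 := by simp [expNeg]

lemma expNeg_le_one (x : ℝ≥0∞) : expNeg x ≤ 1 := by
  simp [expNeg]

/-- Finiteness matters: since `⊤.toReal = 0`, the value at `⊤` is `1`, not `0`. -/
lemma expNeg_add {x y : ℝ≥0∞} (hx : x ≠ ⊤) (hy : y ≠ ⊤) :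
    expNeg (x + y) = expNeg x * expNeg y := by
  rw [expNeg, expNeg, expNeg, ENNReal.toReal_add hx hy, neg_add, Real.exp_add,
    ENNReal.ofReal_mul (Real.exp_nonneg _)]

lemma expNeg_sum {ι : Type*} (s : Finset ι) (x : ι → ℝ≥0∞) (hx : ∀ i ∈ s, x i ≠ ⊤) :
    expNeg (∑ i ∈ s, x i) = ∏ i ∈ s, expNeg (x i) := by
  classical
  induction s using Finset.induction_on with
  | empty => simp [expNeg_zero]
  | insert a s ha ih =>
    rw [Finset.sum_insert ha, Finset.prod_insert ha, expNeg_add (hx a (by simp)),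
      ih fun i hi => hx i (by simp [hi])]
    exact ENNReal.sum_ne_top.2 fun i hi => hx i (by simp [hi])

lemma measurable_expNeg : Measurable expNeg := by
  unfold expNeg; fun_prop

lemma continuousAt_expNeg {x : ℝ≥0∞} (hx : x ≠ ⊤) : ContinuousAt expNeg x := by
  unfold expNeg
  exact ENNReal.continuous_ofReal.continuousAt.comp
    (Real.continuous_exp.continuousAt.comp (ENNReal.continuousAt_toReal hx).neg)

lemma antitone_prod_range {a : ℕ → ℝ≥0∞} (ha : ∀ j, a j ≤ 1) :
    Antitone fun n => ∏ j ∈ Finset.range n, a j := by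
  refine antitone_nat_of_succ_le fun n => ?_
  rw [Finset.prod_range_succ]
  exact mul_le_of_le_one_right' (ha n)

lemma tendsto_prod_range_iInf {a : ℕ → ℝ≥0∞} (ha : ∀ j, a j ≤ 1) :
    Tendsto (fun n => ∏ j ∈ Finset.range n, a j) atTop (𝓝 (⨅ n, ∏ j ∈ Finset.range n, a j)) :=
  tendsto_atTop_iInf (antitone_prod_range ha)

lemma iInf_prod_le_one {a : ℕ → ℝ≥0∞} : ⨅ n, ∏ j ∈ Finset.range n, a j ≤ 1 :=
  (iInf_le _ 0).trans (by simp)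

/-- The `N`-th power of `q ≤ 1` for `N` in `ℕ∞`, as an infimum. -/
noncomputable def infPow (q : ℝ≥0∞) (N : ℕ∞) : ℝ≥0∞ := ⨅ m : ℕ, ⨅ _ : (m : ℕ∞) ≤ N, q ^ m

lemma infPow_natCast {q : ℝ≥0∞} (hq : q ≤ 1) (n : ℕ) : infPow q n = q ^ n := by
  unfold infPow
  refine le_antisymm ((iInf_le _ n).trans (iInf_le _ le_rfl)) (le_iInf₂ fun m hm => ?_)
  exact pow_le_pow_right_of_le_one' hq (by exact_mod_cast hm)

lemma infPow_one (N : ℕ∞) : infPow 1 N = 1 := by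
  unfold infPow
  refine le_antisymm ((iInf₂_le 0 (by simp)).trans (by simp)) (le_iInf₂ fun m _ => by simp)

/-- Only indices in `A` contribute a factor, and each finite part of `A` lies in some initial
segment. Infinite `A` is included. -/
lemma iInf_prod_ite_eq_infPow {q : ℝ≥0∞} (hq : q ≤ 1) (A : Set ℕ) [DecidablePred (· ∈ A)] :
    ⨅ n, ∏ j ∈ Finset.range n, (if j ∈ A then q else 1) = infPow q A.encard := by
  have h : ∀ n, ∏ j ∈ Finset.range n, (if j ∈ A then q else 1)
      = q ^ ((Finset.range n).filter (· ∈ A)).card := by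
    intro n; simp [Finset.prod_ite]
  simp_rw [h]
  unfold infPow
  refine le_antisymm (le_iInf₂ fun m hm => ?_) (le_iInf fun n => iInf₂_le _ ?_)
  · obtain ⟨B, hBA, hB⟩ := Set.exists_subset_encard_eq hm
    have hBfin : B.Finite := Set.finite_of_encard_eq_coe hB
    obtain ⟨n, hn⟩ := hBfin.bddAbove
    refine (iInf_le _ (n + 1)).trans (pow_le_pow_right_of_le_one' hq ?_)
    have : hBfin.toFinset ⊆ (Finset.range (n + 1)).filter (· ∈ A) := by
      intro j hj
      have hj' : j ∈ B := by simpa using hj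
      simp [hBA hj', Nat.lt_succ_of_le (hn hj')]
    refine le_trans ?_ (Finset.card_le_card this)
    rw [hBfin.encard_eq_coe_toFinset_card] at hB
    exact_mod_cast hB.ge
  · rw [← Set.encard_coe_eq_coe_finsetCard]
    exact Set.encard_le_encard fun j hj => by simpa using (Finset.mem_filter.1 hj).2

/-! ### The generating functional of a Poisson point process. -/

section PointProcess

variable {Ω E : Type*} [MeasurableSpace Ω] [MeasurableSpace E] {μ : Measure Ω}
  {X : ℕ → Ω → E} {ν : Measure E}

lemma measurable_pointCount (hX : ∀ i, Measurable (X i)) {B : Set E} (hB : MeasurableSet B) :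
    Measurable (pointCount X B) := by
  refine measurable_encard.comp ?_
  rw [measurable_set_iff]
  intro i
  exact (measurable_mem.2 hB).comp (hX i)

namespace IsPoissonPointProcess

variable [IsProbabilityMeasure μ]

lemma ae_pointCount_ne_top (hX : IsPoissonPointProcess μ X ν) {B : Set E} (hB : MeasurableSet B)
    (hνB : ν B ≠ ⊤) : ∀ᵐ ω ∂μ, pointCount X B ω ≠ ⊤ := by
  have hm := measurable_pointCount hX.measurable hB
  have h1 : μ (⋃ n : ℕ, {ω | pointCount X B ω = n}) = 1 := by
    rw [measure_iUnion]
    · simp_rw [hX.count_law B hB hνB]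
      rw [← measure_iUnion]
      · rw [Set.iUnion_of_singleton]
        exact measure_univ
      · intro a b hab; simpa [Function.onFun] using hab
      · exact fun _ => MeasurableSet.of_discrete
    · intro a b hab
      refine Set.disjoint_left.2 fun ω ha hb => hab ?_
      have : (a : ℕ∞) = b := (Eq.symm ha).trans hb
      exact_mod_cast this
    · exact fun n => hm (MeasurableSet.of_discrete (s := {(n : ℕ∞)}))
  have h2 := (prob_compl_eq_zero_iff
    (MeasurableSet.iUnion fun n : ℕ => hm (MeasurableSet.of_discrete (s := {(n : ℕ∞)})))).2 h1
  refine measure_mono_null ?_ h2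
  intro ω hω
  have hω' : pointCount X B ω = ⊤ := by simpa using hω
  simp [hω']

lemma lintegral_infPow_pointCount (hX : IsPoissonPointProcess μ X ν) {B : Set E}
    (hB : MeasurableSet B) {c : ℝ≥0∞} (hc : c ≤ 1) (hcB : c * ν B ≠ ⊤) :
    ∫⁻ ω, infPow (1 - c) (pointCount X B ω) ∂μ = expNeg (c * ν B) := by
  have hm := measurable_pointCount hX.measurable hB
  -- For `c = 0` the set may have infinite intensity, where `count_law` is silent; both sides are
  -- then `1`.
  rcases eq_or_ne c 0 with rfl | hc0
  · simp [infPow_one, expNeg_zero]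
  have hνB : ν B ≠ ⊤ := fun h => hcB (by simp [h, hc0])
  have hc' : c ≠ ⊤ := ne_top_of_le_ne_top ENNReal.one_ne_top hc
  have hms : ∀ n : ℕ, MeasurableSet {ω | pointCount X B ω = n} := fun n =>
    hm (MeasurableSet.of_discrete (s := {(n : ℕ∞)}))
  have hU : ∫⁻ ω, infPow (1 - c) (pointCount X B ω) ∂μ
      = ∫⁻ ω in ⋃ n : ℕ, {ω | pointCount X B ω = n}, infPow (1 - c) (pointCount X B ω) ∂μ := by
    rw [← setLIntegral_univ]
    refine setLIntegral_congr ?_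
    filter_upwards [hX.ae_pointCount_ne_top hB hνB] with ω hω
    obtain ⟨n, hn⟩ := ENat.ne_top_iff_exists.1 hω
    exact propext ⟨fun _ => Set.mem_iUnion.2 ⟨n, hn.symm⟩, fun _ => trivial⟩
  rw [hU, lintegral_iUnion hms]
  · have hn : ∀ n : ℕ, ∫⁻ ω in {ω | pointCount X B ω = n}, infPow (1 - c) (pointCount X B ω) ∂μ
        = ENNReal.ofReal (Real.exp (-(ν B).toReal) *
          (((1 - c.toReal) * (ν B).toReal) ^ n / n.factorial)) := by
      intro n
      rw [setLIntegral_congr_fun (g := fun _ => (1 - c) ^ n) (hms n), setLIntegral_const,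
        hX.count_law B hB hνB, poissonMeasure_singleton]
      · have : 1 - c = ENNReal.ofReal (1 - c.toReal) := by
          rw [ENNReal.ofReal_sub _ ENNReal.toReal_nonneg, ENNReal.ofReal_toReal hc',
            ENNReal.ofReal_one]
        rw [this, ← ENNReal.ofReal_pow, ← ENNReal.ofReal_mul]
        · congr 1
          simp only [ENNReal.coe_toNNReal_eq_toReal]
          rw [mul_pow]; ring
        · have : c.toReal ≤ 1 := ENNReal.toReal_le_of_le_ofReal zero_le_one (by simpa using hc)
          have : 0 ≤ 1 - c.toReal := by linarith
          positivity
        · have : c.toReal ≤ 1 := ENNReal.toReal_le_of_le_ofReal zero_le_one (by simpa using hc)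
          linarith
      · intro ω hω
        have : pointCount X B ω = n := hω
        simp [this, infPow_natCast]
    simp_rw [hn]
    have hc1 : c.toReal ≤ 1 := ENNReal.toReal_le_of_le_ofReal zero_le_one (by simpa using hc)
    have hnn : 0 ≤ 1 - c.toReal := by linarith
    have hs := (NormedSpace.expSeries_div_hasSum_exp ((1 - c.toReal) * (ν B).toReal)).mul_left
      (Real.exp (-(ν B).toReal))
    rw [← ENNReal.ofReal_tsum_of_nonneg _ hs.summable, hs.tsum_eq, ← Real.exp_eq_exp_ℝ,
      ← Real.exp_add, expNeg, ENNReal.toReal_mul]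
    · congr 2; ring
    · intro n; positivity
  · intro a b hab
    refine Set.disjoint_left.2 fun ω ha hb => hab ?_
    have : (a : ℕ∞) = b := (Eq.symm ha).trans hb
    exact_mod_cast this

/-- Grouping the points by the value of `s` gives one factor `(1 - c) ^ count` per level set. The
level sets are disjoint, so the counts are independent, and each factor has the Poisson generating
function as its mean. -/
lemma lintegral_iInf_prod_simpleFunc (hX : IsPoissonPointProcess μ X ν) (s : SimpleFunc E ℝ≥0∞)
    (hs : ∀ x, s x ≤ 1) (hfin : ∫⁻ x, s x ∂ν ≠ ⊤) :
    ∫⁻ ω, ⨅ n, ∏ j ∈ Finset.range n, (1 - s (X j ω)) ∂μ = expNeg (∫⁻ x, s x ∂ν) := by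
  classical
  have hc1 : ∀ c ∈ s.range, c ≤ 1 := by
    intro c hc
    obtain ⟨x, rfl⟩ := SimpleFunc.mem_range.1 hc
    exact hs x
  have hint : ∫⁻ x, s x ∂ν = ∑ c ∈ s.range, c * ν (s ⁻¹' {c}) := by
    rw [SimpleFunc.lintegral_eq_lintegral, SimpleFunc.lintegral]
  have hfinc : ∀ c ∈ s.range, c * ν (s ⁻¹' {c}) ≠ ⊤ := by
    rw [hint] at hfin
    exact fun c hc => ENNReal.sum_ne_top.1 hfin c hc
  have hpt : ∀ ω, ⨅ n, ∏ j ∈ Finset.range n, (1 - s (X j ω))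
      = ∏ c ∈ s.range, infPow (1 - c) (pointCount X (s ⁻¹' {c}) ω) := by
    intro ω
    -- Read the infima as limits of decreasing sequences; limits pass through the finite product
    -- over values.
    refine tendsto_nhds_unique (tendsto_prod_range_iInf fun j => tsub_le_self) ?_
    have h1 : ∀ n, ∏ j ∈ Finset.range n, (1 - s (X j ω)) =
        ∏ c ∈ s.range, ∏ j ∈ Finset.range n,
          (if j ∈ {i : ℕ | X i ω ∈ s ⁻¹' {c}} then (1 - c) else 1) := by
      intro n
      rw [Finset.prod_comm]
      refine Finset.prod_congr rfl fun j _ => ?_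
      simp
    simp_rw [h1]
    refine ENNReal.tendsto_finsetProd_of_ne_top _ (fun c _ => ?_) fun c _ => ?_
    · rw [pointCount, ← iInf_prod_ite_eq_infPow tsub_le_self]
      refine tendsto_prod_range_iInf fun j => ?_
      split_ifs
      · exact tsub_le_self
      · exact le_rfl
    · rw [pointCount, ← iInf_prod_ite_eq_infPow tsub_le_self]
      exact ne_top_of_le_ne_top ENNReal.one_ne_top iInf_prod_le_one
  simp_rw [hpt]
  let e := s.range.equivFin
  have hprod : ∀ F : ℝ≥0∞ → ℝ≥0∞, ∏ c ∈ s.range, F c = ∏ i, F (e.symm i) := by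
    intro F
    rw [← Finset.prod_coe_sort, ← Equiv.prod_comp e.symm]
  have hind := hX.count_indep _ (fun i => s ⁻¹' {((e.symm i : s.range) : ℝ≥0∞)})
    (fun i => s.measurableSet_preimage _) (by
      intro i j hij
      refine Disjoint.preimage _ ?_
      rw [Set.disjoint_singleton]
      intro h
      exact hij (e.symm.injective (Subtype.ext h)))
  have hind' := hind.comp (fun i => infPow (1 - ((e.symm i : s.range) : ℝ≥0∞)))
    (fun i => Measurable.of_discrete)
  have hl := lintegral_prod_eq_prod_lintegral_of_indepFun Finset.univ _ hind' (fun i =>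
    Measurable.of_discrete.comp (measurable_pointCount hX.measurable (s.measurableSet_preimage _)))
  have : ∀ ω, ∏ c ∈ s.range, infPow (1 - c) (pointCount X (s ⁻¹' {c}) ω)
      = ∏ i, infPow (1 - ((e.symm i : s.range) : ℝ≥0∞))
        (pointCount X (s ⁻¹' {((e.symm i : s.range) : ℝ≥0∞)}) ω) := fun ω =>
    hprod fun c => infPow (1 - c) (pointCount X (s ⁻¹' {c}) ω)
  simp_rw [this]
  refine hl.trans ?_
  rw [hint, expNeg_sum _ _ hfinc, hprod fun c => expNeg (c * ν (s ⁻¹' {c}))]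
  refine Finset.prod_congr rfl fun i _ => ?_
  exact hX.lintegral_infPow_pointCount (s.measurableSet_preimage _) (hc1 _ (e.symm i).2)
    (hfinc _ (e.symm i).2)

/-- The probability generating functional of a Poisson point process. -/
theorem lintegral_iInf_prod (hX : IsPoissonPointProcess μ X ν) {p : E → ℝ≥0∞}
    (hp : Measurable p) (hp1 : ∀ x, p x ≤ 1) (hfin : ∫⁻ x, p x ∂ν ≠ ⊤) :
    ∫⁻ ω, ⨅ n, ∏ j ∈ Finset.range n, (1 - p (X j ω)) ∂μ = expNeg (∫⁻ x, p x ∂ν) := by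
  have hle : ∀ k x, SimpleFunc.eapprox p k x ≤ p x := fun k x => by
    rw [← SimpleFunc.iSup_eapprox_apply hp x]
    exact le_iSup (fun k => SimpleFunc.eapprox p k x) k
  have hfin' : ∀ k, ∫⁻ x, SimpleFunc.eapprox p k x ∂ν ≠ ⊤ := fun k =>
    ne_top_of_le_ne_top hfin (lintegral_mono (hle k))
  have hk : ∀ k, ∫⁻ ω, ⨅ n, ∏ j ∈ Finset.range n, (1 - SimpleFunc.eapprox p k (X j ω)) ∂μ
      = expNeg (∫⁻ x, SimpleFunc.eapprox p k x ∂ν) := fun k =>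
    hX.lintegral_iInf_prod_simpleFunc _ (fun x => (hle k x).trans (hp1 x)) (hfin' k)
  have hlim1 : Tendsto (fun k => ∫⁻ x, SimpleFunc.eapprox p k x ∂ν) atTop
      (𝓝 (∫⁻ x, p x ∂ν)) :=
    lintegral_tendsto_of_tendsto_of_monotone
      (fun k => (SimpleFunc.eapprox p k).measurable.aemeasurable)
      (ae_of_all _ fun x k l hkl => SimpleFunc.monotone_eapprox p hkl x)
      (ae_of_all _ fun x => SimpleFunc.tendsto_eapprox hp x)
  have hpt : ∀ ω, ⨅ n, ∏ j ∈ Finset.range n, (1 - p (X j ω))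
      = ⨅ k, ⨅ n, ∏ j ∈ Finset.range n, (1 - SimpleFunc.eapprox p k (X j ω)) := by
    intro ω
    -- The two infima commute, so the limit in `k` is needed only for finite products.
    rw [iInf_comm]
    refine iInf_congr fun n => ?_
    refine tendsto_nhds_unique
      (f := fun k => ∏ j ∈ Finset.range n, (1 - SimpleFunc.eapprox p k (X j ω)))
      (ENNReal.tendsto_finsetProd_of_ne_top _ (fun j _ => ?_) fun j _ => ?_)
      (tendsto_atTop_iInf fun k l hkl => Finset.prod_le_prod' fun j _ => ?_)
    · exact ENNReal.Tendsto.sub tendsto_const_nhds (SimpleFunc.tendsto_eapprox hp _)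
        (Or.inl ENNReal.one_ne_top)
    · exact ne_top_of_le_ne_top ENNReal.one_ne_top tsub_le_self
    · exact tsub_le_tsub_left (SimpleFunc.monotone_eapprox p hkl _) _
  simp_rw [hpt]
  have hmeas : ∀ k, Measurable
      fun ω => ⨅ n, ∏ j ∈ Finset.range n, (1 - SimpleFunc.eapprox p k (X j ω)) := fun k =>
    Measurable.iInf fun n => Finset.measurable_fun_prod _ fun j _ =>
      ((SimpleFunc.eapprox p k).measurable.comp (hX.measurable j)).const_sub 1
  have hanti : Antitone fun k ω =>
      ⨅ n, ∏ j ∈ Finset.range n, (1 - SimpleFunc.eapprox p k (X j ω)) := by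
    intro k l hkl ω
    exact iInf_mono fun n => Finset.prod_le_prod' fun j _ =>
      tsub_le_tsub_left (SimpleFunc.monotone_eapprox p hkl _) _
  rw [lintegral_iInf hmeas hanti]
  · refine tendsto_nhds_unique (f := fun k => expNeg (∫⁻ x, SimpleFunc.eapprox p k x ∂ν)) ?_
      ((continuousAt_expNeg hfin).tendsto.comp hlim1)
    simp_rw [← hk]
    exact tendsto_atTop_iInf fun k l hkl => lintegral_mono (hanti hkl)
  · rw [hk]
    exact ne_top_of_le_ne_top ENNReal.one_ne_top (expNeg_le_one _)

end IsPoissonPointProcess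

end PointProcess

lemma one_sub_expNeg_le (x : ℝ≥0∞) : 1 - expNeg x ≤ x := by
  rw [expNeg, ← ENNReal.ofReal_one, ← ENNReal.ofReal_sub _ (Real.exp_nonneg _)]
  refine ENNReal.ofReal_le_of_le_toReal ?_
  linarith [Real.add_one_le_exp (-x.toReal)]

/-! ### Void probabilities after independent marking. -/

section Marking

variable {Ω E F : Type*} [MeasurableSpace Ω] [MeasurableSpace E] [MeasurableSpace F]
  {μ : Measure Ω} [IsProbabilityMeasure μ] {X : ℕ → Ω → E} {M : ℕ → Ω → F} {ν : Measure E}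
  {κ : Measure F}

/-- With the positions fixed, which Fubini permits as they are independent of the marks, the i.i.d.
marks avoid their sections of `G` independently. -/
lemma measure_forall_lt_notMem (hX : ∀ i, Measurable (X i)) (hM : ∀ i, Measurable (M i))
    (hlaw : ∀ i, μ.map (M i) = κ) (hMind : iIndepFun M μ)
    (hXM : IndepFun (fun ω i => X i ω) (fun ω i => M i ω) μ) {G : Set (E × F)}
    (hG : MeasurableSet G) (n : ℕ) :
    μ {ω | ∀ j < n, (X j ω, M j ω) ∉ G}
      = ∫⁻ ω, ∏ j ∈ Finset.range n, (1 - κ (Prod.mk (X j ω) ⁻¹' G)) ∂μ := by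
  have hκ : IsProbabilityMeasure κ := by
    rw [← hlaw 0]; exact Measure.isProbabilityMeasure_map (hM 0).aemeasurable
  have hXm : Measurable fun ω i => X i ω := measurable_pi_lambda _ hX
  have hMm : Measurable fun ω i => M i ω := measurable_pi_lambda _ hM
  have hmap := (indepFun_iff_map_prod_eq_prod_map_map hXm.aemeasurable hMm.aemeasurable).1 hXM
  let S : Set ((ℕ → E) × (ℕ → F)) := {z | ∀ j < n, (z.1 j, z.2 j) ∉ G}
  have hS : MeasurableSet S := by
    have : S = ⋂ j, ⋂ (_ : j < n), (fun z : (ℕ → E) × (ℕ → F) => (z.1 j, z.2 j)) ⁻¹' Gᶜ := by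
      ext z; simp [S]
    rw [this]
    refine MeasurableSet.iInter fun j => MeasurableSet.iInter fun _ => ?_
    exact (by fun_prop : Measurable fun z : (ℕ → E) × (ℕ → F) => (z.1 j, z.2 j)) hG.compl
  have hsec : ∀ x : E, MeasurableSet (Prod.mk x ⁻¹' G) := fun x => measurable_prodMk_left hG
  have h1 : μ {ω | ∀ j < n, (X j ω, M j ω) ∉ G}
      = μ.map (fun ω => (fun i => X i ω, fun i => M i ω)) S := by
    rw [Measure.map_apply (hXm.prodMk hMm) hS]; rfl
  have := Measure.isProbabilityMeasure_map (μ := μ) hMm.aemeasurable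
  have hκm : Measurable fun x => κ (Prod.mk x ⁻¹' G) := measurable_measure_prodMk_left hG
  rw [h1, hmap, Measure.prod_apply hS, lintegral_map (measurable_measure_prodMk_left hS) hXm]
  refine lintegral_congr fun ω => ?_
  rw [Measure.map_apply hMm (measurable_prodMk_left hS)]
  have h2 : (fun ω i => M i ω) ⁻¹' (Prod.mk (fun i => X i ω) ⁻¹' S)
      = ⋂ j ∈ Finset.range n, M j ⁻¹' (Prod.mk (X j ω) ⁻¹' G)ᶜ := by
    ext ω'; simp [S]
  rw [h2, hMind.measure_inter_preimage_eq_mul _ fun j _ => (hsec (X j ω)).compl]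
  refine Finset.prod_congr rfl fun j _ => ?_
  rw [← Measure.map_apply (hM j) (hsec _).compl, hlaw, prob_compl_eq_one_sub (hsec _)]

/-- Void probabilities of an independently marked Poisson point process. -/
theorem IsPoissonPointProcess.measure_forall_notMem (hX : IsPoissonPointProcess μ X ν)
    [SFinite ν] (hM : ∀ i, Measurable (M i)) (hlaw : ∀ i, μ.map (M i) = κ)
    (hMind : iIndepFun M μ) (hXM : IndepFun (fun ω i => X i ω) (fun ω i => M i ω) μ)
    {G : Set (E × F)} (hG : MeasurableSet G) (hfin : ν.prod κ G ≠ ⊤) :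
    μ {ω | ∀ j, (X j ω, M j ω) ∉ G} = expNeg (ν.prod κ G) := by
  have hκ : IsProbabilityMeasure κ := by
    rw [← hlaw 0]; exact Measure.isProbabilityMeasure_map (hM 0).aemeasurable
  have hκm : Measurable fun x => κ (Prod.mk x ⁻¹' G) := measurable_measure_prodMk_left hG
  have hle : ∀ j ω, 1 - κ (Prod.mk (X j ω) ⁻¹' G) ≤ 1 := fun j ω => tsub_le_self
  have hS : ∀ n, MeasurableSet {ω | ∀ j < n, (X j ω, M j ω) ∉ G} := fun n => by
    have : {ω | ∀ j < n, (X j ω, M j ω) ∉ G}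
        = ⋂ j, ⋂ (_ : j < n), (fun ω => (X j ω, M j ω)) ⁻¹' Gᶜ := by ext z; simp
    rw [this]
    exact MeasurableSet.iInter fun j => MeasurableSet.iInter fun _ =>
      ((hX.measurable j).prodMk (hM j)) hG.compl
  have h1 : {ω | ∀ j, (X j ω, M j ω) ∉ G} = ⋂ n, {ω | ∀ j < n, (X j ω, M j ω) ∉ G} := by
    ext ω
    simp only [mem_ofPred_eq, mem_iInter]
    exact ⟨fun h n j _ => h j, fun h j => h (j + 1) j (Nat.lt_succ_self j)⟩
  have hanti : Antitone fun n => {ω | ∀ j < n, (X j ω, M j ω) ∉ G} := fun k l hkl ω hω j hj =>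
    hω j (hj.trans_le hkl)
  rw [h1, hanti.measure_iInter (fun n => (hS n).nullMeasurableSet) ⟨0, measure_ne_top _ _⟩]
  simp_rw [measure_forall_lt_notMem hX.measurable hM hlaw hMind hXM hG]
  rw [← lintegral_iInf, hX.lintegral_iInf_prod hκm (fun x => prob_le_one), Measure.prod_apply hG]
  · rwa [← Measure.prod_apply hG]
  · exact fun n => Finset.measurable_fun_prod _ fun j _ =>
      (hκm.comp (hX.measurable j)).const_sub 1
  · exact fun k l hkl ω => antitone_prod_range (fun j => hle j ω) hkl
  · simp

end Marking

/-! ### Common minimisers of two functions on a point process. -/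

section VoidProbabilities

variable {Ω W : Type*} [MeasurableSpace Ω] [MeasurableSpace W] {μ : Measure Ω}
  [IsProbabilityMeasure μ] {Z : ℕ → Ω → W} {N : Measure W}

/-- The event is a difference of two void events, for `G` and for `G ∪ D`, so its probability is
`exp (-N G) * (1 - exp (-N D))`. The linear bound in `N D` makes the estimates for cells add up to
an integral. -/
lemma measure_exists_mem_forall_notMem_le (hZ : ∀ j, Measurable (Z j))
    (hvoid : ∀ G, MeasurableSet G → N G ≠ ⊤ → μ {ω | ∀ j, Z j ω ∉ G} = expNeg (N G))
    {D G : Set W} (hD : MeasurableSet D) (hG : MeasurableSet G) (hND : N D ≠ ⊤) (hNG : N G ≠ ⊤)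
    (hDG : Disjoint D G) :
    μ {ω | (∃ j, Z j ω ∈ D) ∧ ∀ j, Z j ω ∉ G} ≤ expNeg (N G) * N D := by
  have hm : ∀ S, MeasurableSet S → MeasurableSet {ω | ∀ j, Z j ω ∉ S} := fun S hS => by
    have : {ω | ∀ j, Z j ω ∉ S} = ⋂ j, Z j ⁻¹' Sᶜ := by ext; simp
    rw [this]
    exact MeasurableSet.iInter fun j => hZ j hS.compl
  have hU : N (G ∪ D) = N G + N D := measure_union hDG.symm hD
  have hUfin : N (G ∪ D) ≠ ⊤ := by rw [hU]; exact ENNReal.add_ne_top.2 ⟨hNG, hND⟩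
  have heq : {ω | (∃ j, Z j ω ∈ D) ∧ ∀ j, Z j ω ∉ G}
      = {ω | ∀ j, Z j ω ∉ G} \ {ω | ∀ j, Z j ω ∉ G ∪ D} := by
    ext ω
    simp only [mem_ofPred_eq, Set.mem_sdiff, mem_union, not_or]
    constructor
    · rintro ⟨⟨j, hj⟩, h⟩
      exact ⟨h, fun h' => (h' j).2 hj⟩
    · rintro ⟨h, h'⟩
      refine ⟨?_, h⟩
      by_contra hc
      push Not at hc
      exact h' fun j => ⟨h j, hc j⟩
  rw [heq, measure_sdiff _ (hm _ (hG.union hD)).nullMeasurableSet (measure_ne_top _ _),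
    hvoid _ hG hNG, hvoid _ (hG.union hD) hUfin, hU, expNeg_add hNG hND]
  · calc expNeg (N G) - expNeg (N G) * expNeg (N D)
        = expNeg (N G) * (1 - expNeg (N D)) := by
          rw [ENNReal.mul_sub fun _ _ => ne_top_of_le_ne_top ENNReal.one_ne_top (expNeg_le_one _),
            mul_one]
      _ ≤ expNeg (N G) * N D := by gcongr; exact one_sub_expNeg_le _
  · intro ω hω j hj
    exact hω j (Or.inl hj)

/-- The largest multiple of `1 / (k + 1)` below `x`. -/
noncomputable def gridFloor (k : ℕ) (x : ℝ) : ℝ := ⌊((k : ℝ) + 1) * x⌋₊ / ((k : ℝ) + 1)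

lemma gridFloor_le (k : ℕ) {x : ℝ} (hx : 0 ≤ x) : gridFloor k x ≤ x := by
  have hk : (0 : ℝ) < (k : ℝ) + 1 := by positivity
  rw [gridFloor, div_le_iff₀ hk, mul_comm x]
  exact Nat.floor_le (by positivity)

lemma tendsto_gridFloor {x : ℝ} (hx : 0 ≤ x) : Tendsto (fun k => gridFloor k x) atTop (𝓝 x) := by
  have h := (tendsto_nat_floor_mul_div_atTop hx).comp
    (tendsto_atTop_add_const_right atTop (1 : ℝ) tendsto_natCast_atTop_atTop)
  refine h.congr fun k => ?_
  simp [gridFloor, mul_comm]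

lemma measurable_gridFloor (k : ℕ) : Measurable (gridFloor k) := by
  unfold gridFloor
  have : Measurable fun x : ℝ => ((⌊((k : ℝ) + 1) * x⌋₊ : ℕ) : ℝ) :=
    measurable_from_top.comp (Nat.measurable_floor.comp (measurable_const_mul _))
  exact this.div_const _

lemma measurableSet_lt_or_lt {r R : W → ℝ} (hr : Measurable r) (hR : Measurable R) (a b : ℝ) :
    MeasurableSet {w | r w < a ∨ R w < b} :=
  (measurableSet_lt hr measurable_const).union (measurableSet_lt hR measurable_const)

lemma measurable_measure_lt_or_lt [SFinite N] {r R : W → ℝ} (hr : Measurable r)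
    (hR : Measurable R) :
    Measurable fun z : ℝ × ℝ => N {w | r w < z.1 ∨ R w < z.2} := by
  have : MeasurableSet {p : (ℝ × ℝ) × W | r p.2 < p.1.1 ∨ R p.2 < p.1.2} :=
    (measurableSet_lt (hr.comp measurable_snd) (measurable_fst.comp measurable_fst)).union
      (measurableSet_lt (hR.comp measurable_snd) (measurable_snd.comp measurable_fst))
  exact measurable_measure_prodMk_left this

lemma measure_exists_argmin_lt_le_gridFloor [SFinite N] (hZ : ∀ j, Measurable (Z j))
    (hvoid : ∀ G, MeasurableSet G → N G ≠ ⊤ → μ {ω | ∀ j, Z j ω ∉ G} = expNeg (N G))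
    {r R : W → ℝ} (hr : Measurable r) (hR : Measurable R) (hr0 : ∀ w, 0 ≤ r w)
    (hR0 : ∀ w, 0 ≤ R w) (hfin : ∀ a b : ℝ, N {w | r w < a ∨ R w < b} ≠ ⊤) (m : ℝ) (k : ℕ) :
    μ {ω | ∃ i, r (Z i ω) < m ∧ ∀ j, r (Z i ω) ≤ r (Z j ω) ∧ R (Z i ω) ≤ R (Z j ω)}
      ≤ ∫⁻ z in {z | r z < m},
        expNeg (N {w | r w < gridFloor k (r z) ∨ R w < gridFloor k (R z)}) ∂N := by
  -- On a cell `D ab` both rounded values are constant. A minimiser in `D ab` forces `G ab` to be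
  -- empty of points, and rounding down keeps `G ab` disjoint from the cell.
  let D : ℕ × ℕ → Set W := fun ab =>
    {z | r z < m ∧ ⌊((k : ℝ) + 1) * r z⌋₊ = ab.1 ∧ ⌊((k : ℝ) + 1) * R z⌋₊ = ab.2}
  let G : ℕ × ℕ → Set W := fun ab => {w | r w < ab.1 / ((k : ℝ) + 1) ∨ R w < ab.2 / ((k : ℝ) + 1)}
  have hDm : ∀ ab, MeasurableSet (D ab) := fun ab =>
    (measurableSet_lt hr measurable_const).inter
      (((Nat.measurable_floor.comp (hr.const_mul _)) (measurableSet_singleton ab.1)).inter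
        ((Nat.measurable_floor.comp (hR.const_mul _)) (measurableSet_singleton ab.2)))
  have hDG : ∀ ab, ∀ z ∈ D ab,
      {w | r w < gridFloor k (r z) ∨ R w < gridFloor k (R z)} = G ab := by
    rintro ab z ⟨-, h1, h2⟩
    simp only [gridFloor, h1, h2, G]
  have hdisj : ∀ ab, Disjoint (D ab) (G ab) := fun ab => by
    rw [Set.disjoint_left]
    intro z hz hG
    rw [← hDG ab z hz] at hG
    rcases hG with h | h
    · exact h.not_ge (gridFloor_le k (hr0 z))
    · exact h.not_ge (gridFloor_le k (hR0 z))
  have hND : ∀ ab, N (D ab) ≠ ⊤ := fun ab =>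
    ne_top_of_le_ne_top (hfin m 0) (measure_mono fun z hz => Or.inl hz.1)
  have hsub : {ω | ∃ i, r (Z i ω) < m ∧ ∀ j, r (Z i ω) ≤ r (Z j ω) ∧ R (Z i ω) ≤ R (Z j ω)}
      ⊆ ⋃ ab, {ω | (∃ j, Z j ω ∈ D ab) ∧ ∀ j, Z j ω ∉ G ab} := by
    rintro ω ⟨i, him, hi⟩
    have hz : Z i ω ∈ D (⌊((k : ℝ) + 1) * r (Z i ω)⌋₊, ⌊((k : ℝ) + 1) * R (Z i ω)⌋₊) :=
      ⟨him, rfl, rfl⟩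
    refine mem_iUnion.2 ⟨_, ⟨i, hz⟩, fun j hj => ?_⟩
    rw [← hDG _ _ hz] at hj
    rcases hj with h | h
    · exact h.not_ge ((gridFloor_le k (hr0 _)).trans (hi j).1)
    · exact h.not_ge ((gridFloor_le k (hR0 _)).trans (hi j).2)
  have hUD : {z | r z < m} = ⋃ ab, D ab := by
    ext z
    simp [D]
  calc _ ≤ _ := measure_mono hsub
    _ ≤ ∑' ab, μ {ω | (∃ j, Z j ω ∈ D ab) ∧ ∀ j, Z j ω ∉ G ab} := measure_iUnion_le _
    _ ≤ ∑' ab, ∫⁻ z in D ab,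
        expNeg (N {w | r w < gridFloor k (r z) ∨ R w < gridFloor k (R z)}) ∂N := by
      refine ENNReal.tsum_le_tsum fun ab => ?_
      rw [setLIntegral_congr_fun (g := fun _ => expNeg (N (G ab))) (hDm ab), setLIntegral_const]
      · exact measure_exists_mem_forall_notMem_le hZ hvoid (hDm ab)
          (measurableSet_lt_or_lt hr hR _ _) (hND ab) (hfin _ _) (hdisj ab)
      · intro z hz
        simp only [hDG ab z hz]
    _ = _ := by
      rw [hUD, lintegral_iUnion hDm]
      intro ab cd hne
      refine Set.disjoint_left.2 fun z hz hz' => hne ?_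
      exact Prod.ext (hz.2.1.symm.trans hz'.2.1) (hz.2.2.symm.trans hz'.2.2)

/-- The probability that one and the same point minimizes both `r` and `R`, for a point
process with Poisson void probabilities. -/
theorem measure_exists_argmin_le [SFinite N] (hZ : ∀ j, Measurable (Z j))
    (hvoid : ∀ G, MeasurableSet G → N G ≠ ⊤ → μ {ω | ∀ j, Z j ω ∉ G} = expNeg (N G))
    {r R : W → ℝ} (hr : Measurable r) (hR : Measurable R) (hr0 : ∀ w, 0 ≤ r w)
    (hR0 : ∀ w, 0 ≤ R w) (hfin : ∀ a b : ℝ, N {w | r w < a ∨ R w < b} ≠ ⊤) :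
    μ {ω | ∃ i, ∀ j, r (Z i ω) ≤ r (Z j ω) ∧ R (Z i ω) ≤ R (Z j ω)}
      ≤ ∫⁻ z, expNeg (N {w | r w < r z ∨ R w < R z}) ∂N := by
  have hlim : ∀ m : ℝ, Tendsto (fun k => ∫⁻ z in {z | r z < m},
        expNeg (N {w | r w < gridFloor k (r z) ∨ R w < gridFloor k (R z)}) ∂N) atTop
      (𝓝 (∫⁻ z in {z | r z < m}, expNeg (N {w | r w < r z ∨ R w < R z}) ∂N)) := by
    intro m
    -- The truncation `r z < m` leaves a set of finite intensity, so the constant `1` dominates.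
    refine tendsto_lintegral_of_dominated_convergence (fun _ => 1) (fun k => ?_)
      (fun k => ae_of_all _ fun z => expNeg_le_one _) ?_ (ae_of_all _ fun z => ?_)
    · exact measurable_expNeg.comp ((measurable_measure_lt_or_lt hr hR).comp
        (((measurable_gridFloor k).comp hr).prodMk ((measurable_gridFloor k).comp hR)))
    · rw [lintegral_const, one_mul, Measure.restrict_apply_univ]
      exact ne_top_of_le_ne_top (hfin m 0) (measure_mono fun z hz => Or.inl hz)
    · refine (continuousAt_expNeg (hfin _ _)).tendsto.comp ?_
      refine tendsto_measure_of_tendsto_indicator atTop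
        (fun k => measurableSet_lt_or_lt hr hR _ _) (measurableSet_lt_or_lt hr hR (r z) (R z))
        (hfin _ _) (Eventually.of_forall fun k w hw => ?_) fun w => ?_
      · exact hw.imp (fun h => h.trans_le (gridFloor_le k (hr0 z)))
          fun h => h.trans_le (gridFloor_le k (hR0 z))
      -- A strict inequality survives rounding once the grid is fine enough; none is created, since
      -- rounding goes down.
      · by_cases hw : r w < r z ∨ R w < R z
        · rcases hw with h | h
          · filter_upwards [(tendsto_gridFloor (hr0 z)).eventually (lt_mem_nhds h)] with k hk
            exact ⟨fun _ => Or.inl h, fun _ => Or.inl hk⟩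
          · filter_upwards [(tendsto_gridFloor (hR0 z)).eventually (lt_mem_nhds h)] with k hk
            exact ⟨fun _ => Or.inr h, fun _ => Or.inr hk⟩
        · refine Eventually.of_forall fun k => iff_of_false (fun h => hw ?_) hw
          exact h.imp (fun h => h.trans_le (gridFloor_le k (hr0 z)))
            fun h => h.trans_le (gridFloor_le k (hR0 z))
  have hU : {ω | ∃ i, ∀ j, r (Z i ω) ≤ r (Z j ω) ∧ R (Z i ω) ≤ R (Z j ω)}
      = ⋃ m : ℕ, {ω | ∃ i, r (Z i ω) < m ∧
        ∀ j, r (Z i ω) ≤ r (Z j ω) ∧ R (Z i ω) ≤ R (Z j ω)} := by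
    ext ω
    simp only [mem_ofPred_eq, mem_iUnion]
    constructor
    · rintro ⟨i, hi⟩
      obtain ⟨m, hm⟩ := exists_nat_gt (r (Z i ω))
      exact ⟨m, i, hm, hi⟩
    · rintro ⟨m, i, -, hi⟩
      exact ⟨i, hi⟩
  rw [hU, Monotone.measure_iUnion]
  · refine iSup_le fun m => ?_
    refine (ge_of_tendsto (hlim m) (Eventually.of_forall fun k => ?_)).trans
      (setLIntegral_le_lintegral _ _)
    exact measure_exists_argmin_lt_le_gridFloor hZ hvoid hr hR hr0 hR0 hfin m k
  · rintro a b hab ω ⟨i, hi, h⟩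
    exact ⟨i, hi.trans_le (by exact_mod_cast hab), h⟩

end VoidProbabilities

/-! ### Measurability of the handover event. -/

section Measurability

variable {Ω : Type*} [MeasurableSpace Ω]

lemma measurableSet_exists_of_isOpen {K : Type*} [TopologicalSpace K]
    [TopologicalSpace.SeparableSpace K] {U : K → Ω → Prop} (hopen : ∀ ω, IsOpen {s | U s ω})
    (hU : ∀ s, MeasurableSet {ω | U s ω}) : MeasurableSet {ω | ∃ s, U s ω} := by
  obtain ⟨S, hSc, hSd⟩ := TopologicalSpace.exists_countable_dense K
  have : {ω | ∃ s, U s ω} = ⋃ s ∈ S, {ω | U s ω} := by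
    ext ω
    simp only [mem_ofPred_eq, mem_iUnion]
    constructor
    · rintro ⟨s, hs⟩
      obtain ⟨q, hq, hqS⟩ := hSd.inter_open_nonempty _ (hopen ω) ⟨s, hs⟩
      exact ⟨q, hqS, hq⟩
    · rintro ⟨s, -, hs⟩
      exact ⟨s, hs⟩
  rw [this]
  exact MeasurableSet.biUnion hSc fun s _ => hU s

/-- Relax to finitely many strict inequalities with slack `1 / (m + 1)`: these are open conditions,
and compactness recovers an exact solution as `m` grows. -/
lemma measurableSet_exists_forall_nonneg {K : Type*} [TopologicalSpace K]
    [TopologicalSpace.SeparableSpace K] [CompactSpace K] [FirstCountableTopology K]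
    {g : ℕ → K → Ω → ℝ}
    (hc : ∀ j ω, Continuous fun s => g j s ω) (hm : ∀ j s, Measurable (g j s)) :
    MeasurableSet {ω | ∃ s, ∀ j, 0 ≤ g j s ω} := by
  have : {ω | ∃ s, ∀ j, 0 ≤ g j s ω}
      = ⋂ m : ℕ, {ω | ∃ s, ∀ j ∈ Finset.range m, -(1 / ((m : ℝ) + 1)) < g j s ω} := by
    ext ω
    simp only [mem_ofPred_eq, mem_iInter]
    constructor
    · rintro ⟨s, hs⟩ m
      refine ⟨s, fun j _ => lt_of_lt_of_le ?_ (hs j)⟩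
      rw [neg_lt_zero]; positivity
    · intro h
      choose q hq using h
      obtain ⟨s, φ, hφ, hlim⟩ := CompactSpace.tendsto_subseq q
      refine ⟨s, fun j => ?_⟩
      have h1 : Tendsto (fun k => g j (q (φ k)) ω) atTop (𝓝 (g j s ω)) :=
        ((hc j ω).tendsto s).comp hlim
      have h2 : Tendsto (fun k => -(1 / ((φ k : ℝ) + 1))) atTop (𝓝 0) := by
        have := (tendsto_one_div_add_atTop_nhds_zero_nat (𝕜 := ℝ)).comp hφ.tendsto_atTop
        simpa using this.neg
      refine le_of_tendsto_of_tendsto h2 h1 ?_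
      filter_upwards [eventually_gt_atTop j] with k hk
      exact (hq (φ k) j (Finset.mem_range.2 (hk.trans_le (hφ.id_le k)))).le
  rw [this]
  refine MeasurableSet.iInter fun m => measurableSet_exists_of_isOpen (fun ω => ?_) fun s => ?_
  · have : {s | ∀ j ∈ Finset.range m, -(1 / ((m : ℝ) + 1)) < g j s ω}
        = ⋂ j ∈ Finset.range m, {s | -(1 / ((m : ℝ) + 1)) < g j s ω} := by ext; simp
    rw [this]
    exact isOpen_biInter_finset fun j _ => isOpen_lt continuous_const (hc j ω)
  · have : {ω | ∀ j ∈ Finset.range m, -(1 / ((m : ℝ) + 1)) < g j s ω}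
        = ⋂ j ∈ Finset.range m, {ω | -(1 / ((m : ℝ) + 1)) < g j s ω} := by ext; simp
    rw [this]
    exact Finset.measurableSet_biInter _ fun j _ => measurableSet_lt measurable_const (hm j s)

/-- Two argmin sets differ when some index lies in exactly one of them. Being a minimiser is a
closed condition in `s`, handled on the compact intervals exhausting `[0, t)`; failing to be one is
open. -/
lemma measurableSet_exists_argmin_ne {d : ℕ → ℝ → Ω → ℝ} (hc : ∀ j ω, Continuous fun s => d j s ω)
    (hm : ∀ j s, Measurable (d j s)) (t : ℝ) :
    MeasurableSet {ω | ∃ s, 0 ≤ s ∧ s < t ∧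
      {i | ∀ j, d i s ω ≤ d j s ω} ≠ {i | ∀ j, d i t ω ≤ d j t ω}} := by
  have hmin : ∀ i s, MeasurableSet {ω | ∀ j, d i s ω ≤ d j s ω} := fun i s => by
    have : {ω | ∀ j, d i s ω ≤ d j s ω} = ⋂ j, {ω | d i s ω ≤ d j s ω} := by ext; simp
    rw [this]
    exact MeasurableSet.iInter fun j => measurableSet_le (hm i s) (hm j s)
  have hex : ∀ i, MeasurableSet {ω | ∃ s, 0 ≤ s ∧ s < t ∧ ∀ j, d i s ω ≤ d j s ω} := fun i => by
    have : {ω | ∃ s, 0 ≤ s ∧ s < t ∧ ∀ j, d i s ω ≤ d j s ω} = ⋃ n : ℕ,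
        {ω | ∃ s : Icc (0 : ℝ) (t - 1 / ((n : ℝ) + 1)), ∀ j, 0 ≤ d j s ω - d i s ω} := by
      ext ω
      simp only [mem_ofPred_eq, mem_iUnion]
      constructor
      · rintro ⟨s, h0, hs, h⟩
        obtain ⟨n, hn⟩ := exists_nat_one_div_lt (sub_pos.2 hs)
        exact ⟨n, ⟨s, h0, by linarith⟩, fun j => sub_nonneg.2 (h j)⟩
      · rintro ⟨n, ⟨s, h0, hs⟩, h⟩
        have : (0 : ℝ) < 1 / ((n : ℝ) + 1) := by positivity
        exact ⟨s, h0, by linarith, fun j => sub_nonneg.1 (h j)⟩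
    rw [this]
    exact MeasurableSet.iUnion fun n => measurableSet_exists_forall_nonneg
      (fun j ω => ((hc j ω).comp continuous_subtype_val).sub
        ((hc i ω).comp continuous_subtype_val)) fun j s => (hm j s).sub (hm i s)
  have hnot : ∀ i, MeasurableSet {ω | ∃ s, 0 ≤ s ∧ s < t ∧ ¬ ∀ j, d i s ω ≤ d j s ω} := fun i => by
    have : {ω | ∃ s, 0 ≤ s ∧ s < t ∧ ¬ ∀ j, d i s ω ≤ d j s ω}
        = {ω | ∃ s : Ico (0 : ℝ) t, ∃ j, d j s ω < d i s ω} := by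
      ext ω
      simp only [mem_ofPred_eq, not_forall, not_le]
      constructor
      · rintro ⟨s, h0, hs, h⟩
        exact ⟨⟨s, h0, hs⟩, h⟩
      · rintro ⟨⟨s, h0, hs⟩, h⟩
        exact ⟨s, h0, hs, h⟩
    rw [this]
    refine measurableSet_exists_of_isOpen (fun ω => ?_) fun s => ?_
    · have : {s : Ico (0 : ℝ) t | ∃ j, d j s ω < d i s ω}
          = ⋃ j, {s : Ico (0 : ℝ) t | d j s ω < d i s ω} := by ext; simp
      rw [this]
      exact isOpen_iUnion fun j => isOpen_lt ((hc j ω).comp continuous_subtype_val)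
        ((hc i ω).comp continuous_subtype_val)
    · have : {ω | ∃ j, d j s ω < d i s ω} = ⋃ j, {ω | d j s ω < d i s ω} := by ext; simp
      rw [this]
      exact MeasurableSet.iUnion fun j => measurableSet_lt (hm j s) (hm i s)
  have : {ω | ∃ s, 0 ≤ s ∧ s < t ∧ {i | ∀ j, d i s ω ≤ d j s ω} ≠ {i | ∀ j, d i t ω ≤ d j t ω}}
      = ⋃ i, ({ω | ∃ s, 0 ≤ s ∧ s < t ∧ ∀ j, d i s ω ≤ d j s ω} ∩
          {ω | ∀ j, d i t ω ≤ d j t ω}ᶜ) ∪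
        ({ω | ∃ s, 0 ≤ s ∧ s < t ∧ ¬ ∀ j, d i s ω ≤ d j s ω} ∩
          {ω | ∀ j, d i t ω ≤ d j t ω}) := by
    ext ω
    simp only [mem_ofPred_eq, mem_iUnion, mem_union, mem_inter_iff, mem_compl_iff]
    constructor
    · rintro ⟨s, h0, hs, hne⟩
      have : ∃ i, ¬ ((∀ j, d i s ω ≤ d j s ω) ↔ ∀ j, d i t ω ≤ d j t ω) := by
        by_contra hcon
        push Not at hcon
        exact hne (Set.ext fun i => hcon i)
      obtain ⟨i, hi⟩ := this
      refine ⟨i, ?_⟩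
      by_cases h : ∀ j, d i s ω ≤ d j s ω
      · exact Or.inl ⟨⟨s, h0, hs, h⟩, fun h' => hi (iff_of_true h h')⟩
      · exact Or.inr ⟨⟨s, h0, hs, h⟩, by by_contra h'; exact hi (iff_of_false h h')⟩
    · rintro ⟨i, ⟨⟨s, h0, hs, h⟩, h'⟩ | ⟨⟨s, h0, hs, h⟩, h'⟩⟩
      · exact ⟨s, h0, hs, fun he => h' ((Set.ext_iff.1 he i).1 h)⟩
      · exact ⟨s, h0, hs, fun he => h ((Set.ext_iff.1 he i).2 h')⟩
  rw [this]
  exact MeasurableSet.iUnion fun i => ((hex i).inter (hmin i t).compl).union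
    ((hnot i).inter (hmin i t))

lemma norm_dronePosition (h : ℝ) (x : EuclideanSpace ℝ (Fin 2)) (v θ s : ℝ) :
    ‖dronePosition h x v θ s‖
      = √((x 0 + v * s * Real.cos θ) ^ 2 + (x 1 + v * s * Real.sin θ) ^ 2 + h ^ 2) := by
  simp [dronePosition, EuclideanSpace.norm_eq, Fin.sum_univ_three]

lemma measurableSet_handoverEvent (h t : ℝ) {X : ℕ → Ω → EuclideanSpace ℝ (Fin 2)}
    {V Θ : ℕ → Ω → ℝ} (hX : ∀ i, Measurable (X i)) (hV : ∀ i, Measurable (V i))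
    (hΘ : ∀ i, Measurable (Θ i)) : MeasurableSet (handoverEvent h X V Θ t) := by
  refine measurableSet_exists_argmin_ne
    (d := fun i s ω => ‖dronePosition h (X i ω) (V i ω) (Θ i ω) s‖) (fun i ω => ?_) (fun i s => ?_) t
  · simp_rw [norm_dronePosition]
    fun_prop
  · simp_rw [norm_dronePosition]
    have := hX i
    have := hV i
    have := hΘ i
    fun_prop

end Measurability

/-! ### Existence of a closest point. -/

lemma exists_forall_norm_le_of_finite {E : Type*} [NormedAddCommGroup E] {x : ℕ → E}
    (hx : ∀ m : ℕ, {i | x i ∈ Metric.ball (0 : E) m}.Finite) : ∃ i, ∀ j, ‖x i‖ ≤ ‖x j‖ := by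
  obtain ⟨m, hm⟩ := exists_nat_gt ‖x 0‖
  obtain ⟨i, hi, hmin⟩ := Set.exists_min_image _ (fun i => ‖x i‖) (hx m) ⟨0, by simpa using hm⟩
  refine ⟨i, fun j => ?_⟩
  by_cases hj : x j ∈ Metric.ball (0 : E) m
  · exact hmin j hj
  · have h1 : ‖x i‖ < m := by simpa using hi
    have h2 : (m : ℝ) ≤ ‖x j‖ := by simpa using hj
    exact h1.le.trans h2

lemma IsPoissonPointProcess.ae_exists_forall_norm_le {Ω E : Type*} [MeasurableSpace Ω]
    [NormedAddCommGroup E] [MeasurableSpace E] [OpensMeasurableSpace E] {μ : Measure Ω}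
    [IsProbabilityMeasure μ] {X : ℕ → Ω → E} {ν : Measure E} (hX : IsPoissonPointProcess μ X ν)
    (hν : ∀ m : ℕ, ν (Metric.ball 0 m) ≠ ⊤) : ∀ᵐ ω ∂μ, ∃ i, ∀ j, ‖X i ω‖ ≤ ‖X j ω‖ := by
  have h : ∀ᵐ ω ∂μ, ∀ m : ℕ, pointCount X (Metric.ball 0 m) ω ≠ ⊤ :=
    ae_all_iff.2 fun m => hX.ae_pointCount_ne_top measurableSet_ball (hν m)
  filter_upwards [h] with ω hω
  refine exists_forall_norm_le_of_finite fun m => ?_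
  exact Set.encard_ne_top_iff.1 (hω m)

/-! ### Polar coordinates and uniform directions. -/

lemma lintegral_fun_norm_euclideanPlane {g : ℝ → ℝ≥0∞} (hg : Measurable g) :
    ∫⁻ x : EuclideanSpace ℝ (Fin 2), g ‖x‖
      = ∫⁻ u in Ioi (0 : ℝ), ENNReal.ofReal (2 * Real.pi * u) * g u := by
  let ν : Measure (EuclideanSpace ℝ (Fin 2)) := volume
  have hball : ν (Metric.ball 0 1) = ENNReal.ofReal Real.pi := by
    simp [ν, EuclideanSpace.volume_ball_fin_two]
  calc ∫⁻ x, g ‖x‖ ∂ν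
      = ∫⁻ x : ({(0)}ᶜ : Set (EuclideanSpace ℝ (Fin 2))), g ‖x.1‖ ∂(ν.comap (↑)) := by
        rw [lintegral_subtype_comap (measurableSet_singleton _).compl fun x => g ‖x‖,
          restrict_compl_singleton]
    _ = ∫⁻ x, g x.2 ∂ν.toSphere.prod (.volumeIoiPow
          (Module.finrank ℝ (EuclideanSpace ℝ (Fin 2)) - 1)) := by
        simpa using ν.measurePreserving_homeomorphUnitSphereProd.lintegral_comp_emb
          (Homeomorph.measurableEmbedding _) (g ∘ Subtype.val ∘ Prod.snd)
    _ = ν.toSphere univ * ∫⁻ x : Ioi (0 : ℝ), g x ∂.volumeIoiPow 1 := by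
        rw [lintegral_prod _ (by fun_prop)]
        simp [mul_comm]
    _ = ∫⁻ u in Ioi (0 : ℝ), ENNReal.ofReal (2 * Real.pi * u) * g u := by
        rw [Measure.volumeIoiPow, lintegral_withDensity_eq_lintegral_mul _ (by fun_prop)
          (by fun_prop), ν.toSphere_apply_univ, hball]
        simp only [Pi.mul_apply, finrank_euclideanSpace_fin, pow_one]
        rw [lintegral_subtype_comap measurableSet_Ioi fun u => ENNReal.ofReal u * g u,
          ← lintegral_const_mul _ (by fun_prop)]
        refine setLIntegral_congr_fun measurableSet_Ioi fun u hu => ?_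
        rw [ENNReal.ofReal_mul (by positivity), ENNReal.ofReal_mul (by positivity)]
        simp [mul_assoc]

lemma setLIntegral_Ico_comp_add_of_periodic {g : ℝ → ℝ≥0∞} {T : ℝ} (hT : 0 < T)
    (hg : Function.Periodic g T) (a : ℝ) :
    ∫⁻ x in Ico 0 T, g (x + a) = ∫⁻ x in Ico 0 T, g x := by
  rw [setLIntegral_congr Ico_ae_eq_Ioc, setLIntegral_congr Ico_ae_eq_Ioc]
  have h1 : ∫⁻ x in Ioc 0 T, g (x + a) = ∫⁻ x in Ioc a (a + T), g x := by
    have := (measurePreserving_add_right volume a).setLIntegral_comp_preimage_emb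
      (measurableEmbedding_addRight a) g (Ioc a (a + T))
    rw [← this]
    congr 2
    ext x
    simp only [mem_Ioc, mem_preimage]
    constructor <;> rintro ⟨h1, h2⟩ <;> constructor <;> linarith
  rw [h1]
  -- Both intervals are fundamental domains for translation by multiples of `T`.
  have : VAddInvariantMeasure (AddSubgroup.zmultiples T) ℝ volume :=
    ⟨fun c s _ => measure_preimage_add _ _ _⟩
  have h2 := isAddFundamentalDomain_Ioc hT 0
  rw [zero_add] at h2
  exact (isAddFundamentalDomain_Ioc hT a).setLIntegral_eq h2 _ hg.map_vadd_zmultiples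

/-- The point of the plane with polar coordinates `(ρ, θ)`. -/
noncomputable def polarVec (ρ θ : ℝ) : EuclideanSpace ℝ (Fin 2) :=
  !₂[ρ * Real.cos θ, ρ * Real.sin θ]

lemma continuous_polarVec : Continuous fun z : ℝ × ℝ => polarVec z.1 z.2 := by
  unfold polarVec
  refine (PiLp.continuous_toLp 2 _).comp (continuous_pi fun i => ?_)
  fin_cases i <;> simp <;> fun_prop

lemma exists_polarVec_norm_eq (z : EuclideanSpace ℝ (Fin 2)) : ∃ α, z = polarVec ‖z‖ α := by
  let w : ℂ := ⟨z 0, z 1⟩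
  have hw : ‖w‖ = ‖z‖ := by
    rw [Complex.norm_def, EuclideanSpace.norm_eq, Complex.normSq_apply, Fin.sum_univ_two]
    simp [w, sq]
  refine ⟨w.arg, ?_⟩
  have h0 : ‖z‖ * Real.cos w.arg = z 0 := by rw [← hw, Complex.norm_mul_cos_arg]
  have h1 : ‖z‖ * Real.sin w.arg = z 1 := by rw [← hw, Complex.norm_mul_sin_arg]
  ext i
  fin_cases i
  · simp [polarVec, h0]
  · simp [polarVec, h1]

lemma norm_polarVec_add_polarVec (a α ρ θ : ℝ) :
    ‖polarVec a α + polarVec ρ θ‖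
      = √(a ^ 2 + ρ ^ 2 + 2 * a * ρ * Real.cos (θ - α)) := by
  rw [EuclideanSpace.norm_eq, Fin.sum_univ_two, Real.cos_sub]
  congr 1
  simp [polarVec]
  linear_combination a ^ 2 * Real.sin_sq_add_cos_sq α + ρ ^ 2 * Real.sin_sq_add_cos_sq θ

/-- The uniform distribution on the directions. -/
noncomputable def uniformAngle : Measure ℝ := cond volume (Ico 0 (2 * Real.pi))

lemma volume_Ico_two_pi : volume (Ico 0 (2 * Real.pi)) = ENNReal.ofReal (2 * Real.pi) := by simp

instance : IsProbabilityMeasure uniformAngle :=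
  cond_isProbabilityMeasure_of_finite (by rw [volume_Ico_two_pi]; simp [Real.pi_pos])
    (by rw [volume_Ico_two_pi]; exact ENNReal.ofReal_ne_top)

lemma lintegral_uniformAngle (g : ℝ → ℝ≥0∞) :
    ∫⁻ θ, g θ ∂uniformAngle
      = (ENNReal.ofReal (2 * Real.pi))⁻¹ * ∫⁻ θ in Ico 0 (2 * Real.pi), g θ := by
  rw [uniformAngle, ProbabilityTheory.cond, lintegral_smul_measure, volume_Ico_two_pi, smul_eq_mul]

lemma lintegral_uniformAngle_comp_add {g : ℝ → ℝ≥0∞} (hg : Function.Periodic g (2 * Real.pi))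
    (a : ℝ) : ∫⁻ θ, g (θ + a) ∂uniformAngle = ∫⁻ θ, g θ ∂uniformAngle := by
  rw [lintegral_uniformAngle, lintegral_uniformAngle,
    setLIntegral_Ico_comp_add_of_periodic Real.two_pi_pos hg]

/-- Rotation invariance removes the argument of `z`. The free phase `b` serves to fix the sign of
the cosine: `π` for adding a displacement, `0` for subtracting one. -/
lemma lintegral_uniformAngle_norm_add_polarVec (φ : ℝ → ℝ≥0∞) (z : EuclideanSpace ℝ (Fin 2))
    (ρ b : ℝ) :
    ∫⁻ θ, φ ‖z + polarVec ρ θ‖ ∂uniformAngle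
      = ∫⁻ θ, φ (√(‖z‖ ^ 2 + ρ ^ 2 + 2 * ‖z‖ * ρ * Real.cos (θ + b))) ∂uniformAngle := by
  obtain ⟨α, hα⟩ := exists_polarVec_norm_eq z
  have hper : Function.Periodic
      (fun θ => φ (√(‖z‖ ^ 2 + ρ ^ 2 + 2 * ‖z‖ * ρ * Real.cos θ))) (2 * Real.pi) := fun θ => by
    simp only [Real.cos_add_two_pi]
  rw [lintegral_uniformAngle_comp_add hper b, ← lintegral_uniformAngle_comp_add hper (-α)]
  refine lintegral_congr fun θ => ?_
  rw [← sub_eq_add_neg, ← norm_polarVec_add_polarVec, ← hα]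

lemma lintegral_uniformAngle_norm_add_polarVec_mul (φ : ℝ → ℝ≥0∞)
    (z : EuclideanSpace ℝ (Fin 2)) (v t : ℝ) :
    ∫⁻ θ, φ ‖z + polarVec (v * t) θ‖ ∂uniformAngle
      = ∫⁻ θ, φ (displacedDistance t ‖z‖ v θ) ∂uniformAngle := by
  rw [lintegral_uniformAngle_norm_add_polarVec φ z (v * t) Real.pi]
  refine lintegral_congr fun θ => ?_
  rw [displacedDistance, Real.cos_add_pi]
  congr 2; ring

lemma lintegral_uniformAngle_norm_sub_polarVec_mul (φ : ℝ → ℝ≥0∞)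
    (z : EuclideanSpace ℝ (Fin 2)) (v t : ℝ) :
    ∫⁻ θ, φ ‖z - polarVec (v * t) θ‖ ∂uniformAngle
      = ∫⁻ θ, φ (displacedDistance t ‖z‖ v θ) ∂uniformAngle := by
  have : ∀ θ, z - polarVec (v * t) θ = z + polarVec (-(v * t)) θ := fun θ => by
    rw [sub_eq_add_neg]
    congr 1
    ext i
    fin_cases i <;> simp [polarVec]
  simp_rw [this]
  rw [lintegral_uniformAngle_norm_add_polarVec φ z _ 0]
  refine lintegral_congr fun θ => ?_
  rw [displacedDistance, add_zero]
  congr 2; ring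

lemma uniformAngle_lt_cos (c : ℝ) :
    uniformAngle {θ | c < Real.cos θ} = ENNReal.ofReal (Real.arccos c / Real.pi) := by
  have hpi := Real.pi_pos
  have hac0 := Real.arccos_nonneg c
  have hacpi := Real.arccos_le_pi c
  have key : volume (Ico 0 (2 * Real.pi) ∩ {θ | c < Real.cos θ})
      = ENNReal.ofReal (2 * Real.arccos c) := by
    have hset : (Ico 0 (2 * Real.pi) ∩ {θ | c < Real.cos θ} : Set ℝ) =ᵐ[volume]
        (Ico 0 (Real.arccos c) ∪ Ioo (2 * Real.pi - Real.arccos c) (2 * Real.pi) : Set ℝ) := by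
      -- For `c < -1` the union on the right misses `π`, so equality holds only almost everywhere.
      have hne : ∀ᵐ θ : ℝ, θ ≠ Real.pi := by
        simp [ae_iff]
      filter_upwards [hne] with θ hθ
      refine propext ?_
      change (θ ∈ Ico 0 (2 * Real.pi) ∧ c < Real.cos θ) ↔
        (θ ∈ Ico 0 (Real.arccos c) ∨ θ ∈ Ioo (2 * Real.pi - Real.arccos c) (2 * Real.pi))
      have haux : ∀ x : ℝ, 0 ≤ x → x < Real.pi → (c < Real.cos x ↔ x < Real.arccos c) := by
        intro x h0 hx
        rcases le_or_gt c (-1) with hc | hc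
        · have h1 : Real.arccos c = Real.pi := Real.arccos_of_le_neg_one hc
          have h2 : -1 < Real.cos x := by
            rw [← Real.cos_pi]
            exact Real.cos_lt_cos_of_nonneg_of_le_pi h0 le_rfl hx
          rw [h1]
          exact iff_of_true (by linarith) hx
        rcases le_or_gt c 1 with hc' | hc'
        · constructor
          · intro h
            by_contra hcon
            have := Real.cos_le_cos_of_nonneg_of_le_pi hac0 hx.le (not_lt.1 hcon)
            rw [Real.cos_arccos hc.le hc'] at this
            linarith
          · intro h
            have := Real.cos_lt_cos_of_nonneg_of_le_pi h0 hacpi h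
            rwa [Real.cos_arccos hc.le hc'] at this
        · rw [Real.arccos_of_one_le hc'.le]
          exact iff_of_false (by linarith [Real.cos_le_one x]) (by linarith)
      rcases lt_or_gt_of_ne hθ with hlt | hgt
      · by_cases h0 : 0 ≤ θ
        · rw [haux θ h0 hlt]
          simp only [mem_Ico, mem_Ioo]
          constructor
          · rintro ⟨_, h⟩; exact Or.inl ⟨h0, h⟩
          · rintro (⟨_, h⟩ | ⟨h, _⟩)
            · exact ⟨⟨h0, by linarith⟩, h⟩
            · linarith
        · simp only [mem_Ico, mem_Ioo]
          constructor
          · rintro ⟨⟨h, _⟩, _⟩; exact absurd h h0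
          · rintro (⟨h, _⟩ | ⟨h, _⟩)
            · exact absurd h h0
            · linarith
      · by_cases h2 : θ < 2 * Real.pi
        · have := haux (2 * Real.pi - θ) (by linarith) (by linarith)
          rw [Real.cos_two_pi_sub] at this
          rw [this]
          simp only [mem_Ico, mem_Ioo]
          constructor
          · rintro ⟨_, h⟩; exact Or.inr ⟨by linarith, h2⟩
          · rintro (⟨_, h⟩ | ⟨h, _⟩)
            · linarith
            · exact ⟨⟨by linarith, h2⟩, by linarith⟩
        · simp only [mem_Ico, mem_Ioo]
          constructor
          · rintro ⟨⟨_, h⟩, _⟩; exact absurd h h2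
          · rintro (⟨_, h⟩ | ⟨_, h⟩)
            · linarith
            · exact absurd h h2
    rw [measure_congr hset, measure_union _ measurableSet_Ioo, Real.volume_Ico, Real.volume_Ioo,
      ← ENNReal.ofReal_add (by linarith) (by linarith)]
    · congr 1; ring
    · rw [Set.disjoint_left]
      rintro x ⟨_, h1⟩ ⟨h2, _⟩
      linarith
  rw [uniformAngle, cond_apply measurableSet_Ico, key, volume_Ico_two_pi,
    ← ENNReal.ofReal_inv_of_pos Real.two_pi_pos, ← ENNReal.ofReal_mul (by positivity)]
  congr 1
  field_simp

/-! ### The intensity of the marked drones. -/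

lemma measurable_displacedDistance (t : ℝ) :
    Measurable fun z : ℝ × ℝ × ℝ => displacedDistance t z.1 z.2.1 z.2.2 := by
  unfold displacedDistance
  fun_prop

/-- The law of the pair of speed and direction. -/
noncomputable def motionLaw (f : ℝ → ℝ) : Measure (ℝ × ℝ) := (densityLaw f).prod uniformAngle

/-- The probability that a drone that starts at distance `u` is displaced in time `t` to a distance
at least `a`. -/
noncomputable def farProb (f : ℝ → ℝ) (t a u : ℝ) : ℝ≥0∞ :=
  motionLaw f {m | a ≤ displacedDistance t u m.1 m.2}

/-- The distance from the origin at time `t` of a drone with initial position, speed and direction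
given by `w`. -/
noncomputable def finalDistance (t : ℝ) (w : EuclideanSpace ℝ (Fin 2) × ℝ × ℝ) : ℝ :=
  ‖w.1 + polarVec (w.2.1 * t) w.2.2‖

lemma continuous_finalDistance (t : ℝ) : Continuous (finalDistance t) := by
  have : Continuous fun w : EuclideanSpace ℝ (Fin 2) × ℝ × ℝ => polarVec (w.2.1 * t) w.2.2 :=
    continuous_polarVec.comp (by fun_prop : Continuous
      fun w : EuclideanSpace ℝ (Fin 2) × ℝ × ℝ => (w.2.1 * t, w.2.2))
  exact (continuous_fst.add this).norm

/-- Time reversal: the direction is uniform, so motion traced backwards from `z` has the same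
distance law as forward motion. -/
lemma motionLaw_le_norm_sub_polarVec (f : ℝ → ℝ) (t a : ℝ) (z : EuclideanSpace ℝ (Fin 2)) :
    motionLaw f {m | a ≤ ‖z - polarVec (m.1 * t) m.2‖} = farProb f t a ‖z‖ := by
  have h1 : MeasurableSet {m : ℝ × ℝ | a ≤ ‖z - polarVec (m.1 * t) m.2‖} := by
    refine measurableSet_le measurable_const (Continuous.measurable ?_)
    exact (continuous_const.sub (continuous_polarVec.comp
      (by fun_prop : Continuous fun m : ℝ × ℝ => (m.1 * t, m.2)))).norm
  have h2 : MeasurableSet {m : ℝ × ℝ | a ≤ displacedDistance t ‖z‖ m.1 m.2} :=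
    measurableSet_le measurable_const
      ((measurable_displacedDistance t).comp measurable_prodMk_left)
  rw [farProb, motionLaw, Measure.prod_apply h1, Measure.prod_apply h2]
  refine lintegral_congr fun v => ?_
  have := lintegral_uniformAngle_norm_sub_polarVec_mul ((Ici a).indicator 1) z v t
  rw [← lintegral_indicator_one (measurable_prodMk_left h1),
    ← lintegral_indicator_one (measurable_prodMk_left h2)]
  exact this

section Law

variable {f : ℝ → ℝ} [IsProbabilityMeasure (densityLaw f)]

instance : IsProbabilityMeasure (motionLaw f) := by unfold motionLaw; infer_instance

lemma farProb_le_one (t a u : ℝ) : farProb f t a u ≤ 1 := prob_le_one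

lemma measurable_farProb (t : ℝ) : Measurable fun z : ℝ × ℝ => farProb f t z.1 z.2 := by
  have : MeasurableSet {p : (ℝ × ℝ) × ℝ × ℝ | p.1.1 ≤ displacedDistance t p.1.2 p.2.1 p.2.2} :=
    measurableSet_le (by fun_prop) ((measurable_displacedDistance t).comp
      (by fun_prop : Measurable fun p : (ℝ × ℝ) × ℝ × ℝ => (p.1.2, p.2.1, p.2.2)))
  exact measurable_measure_prodMk_left this

lemma measurable_farProb_right (t a : ℝ) : Measurable (farProb f t a) :=
  (measurable_farProb t).comp measurable_prodMk_left

lemma lintegral_ball_smul_volume (lam0 b : ℝ) {g : ℝ → ℝ≥0∞} (hg : Measurable g) :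
    ∫⁻ z in Metric.ball (0 : EuclideanSpace ℝ (Fin 2)) b, g ‖z‖ ∂(ENNReal.ofReal lam0 • volume)
      = ENNReal.ofReal lam0 * ∫⁻ u in Ioo 0 b, ENNReal.ofReal (2 * Real.pi * u) * g u := by
  rw [Measure.restrict_smul, lintegral_smul_measure, smul_eq_mul,
    ← lintegral_indicator measurableSet_ball]
  have h1 : ∀ z : EuclideanSpace ℝ (Fin 2),
      (Metric.ball (0 : EuclideanSpace ℝ (Fin 2)) b).indicator (fun z => g ‖z‖) z
        = (Iio b).indicator g ‖z‖ := fun z => by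
    by_cases hz : ‖z‖ < b <;> simp [indicator, hz]
  simp_rw [h1]
  rw [lintegral_fun_norm_euclideanPlane (hg.indicator measurableSet_Iio),
    ← lintegral_indicator measurableSet_Ioi, ← lintegral_indicator measurableSet_Ioo]
  congr 1
  refine lintegral_congr fun u => ?_
  by_cases h0 : 0 < u <;> by_cases hb : u < b <;> simp [indicator, h0, hb]

/-- The intensity measure of the drones marked with their speeds and directions. -/
noncomputable def markedIntensity (lam0 : ℝ) (f : ℝ → ℝ) :
    Measure (EuclideanSpace ℝ (Fin 2) × ℝ × ℝ) :=
  (ENNReal.ofReal lam0 • volume : Measure (EuclideanSpace ℝ (Fin 2))).prod (motionLaw f)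

instance (lam0 : ℝ) : SFinite (markedIntensity lam0 f) := by
  unfold markedIntensity; infer_instance

lemma markedIntensity_norm_lt (lam0 a : ℝ) :
    markedIntensity lam0 f {w | ‖w.1‖ < a}
      = (ENNReal.ofReal lam0 • volume : Measure (EuclideanSpace ℝ (Fin 2))) (Metric.ball 0 a) := by
  have : {w : EuclideanSpace ℝ (Fin 2) × ℝ × ℝ | ‖w.1‖ < a} = Metric.ball 0 a ×ˢ univ := by
    ext w; simp
  rw [this, markedIntensity, Measure.prod_prod, measure_univ, mul_one]

/-- For each fixed motion, translation by the displacement preserves the intensity of starting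
points. One may therefore integrate over the final position and ask how likely its starting point
was at distance at least `a`. -/
lemma markedIntensity_le_norm_finalDistance_lt (lam0 t a b : ℝ) :
    markedIntensity lam0 f {w | a ≤ ‖w.1‖ ∧ finalDistance t w < b}
      = ∫⁻ z in Metric.ball (0 : EuclideanSpace ℝ (Fin 2)) b, farProb f t a ‖z‖
          ∂(ENNReal.ofReal lam0 • volume) := by
  let ν : Measure (EuclideanSpace ℝ (Fin 2)) := ENNReal.ofReal lam0 • volume
  have hinv : ν.IsAddRightInvariant := by
    simp only [ν]; infer_instance
  have hpc : Continuous fun p : EuclideanSpace ℝ (Fin 2) × ℝ × ℝ => polarVec (p.2.1 * t) p.2.2 :=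
    continuous_polarVec.comp (by fun_prop : Continuous
      fun w : EuclideanSpace ℝ (Fin 2) × ℝ × ℝ => (w.2.1 * t, w.2.2))
  have hS : MeasurableSet {w : EuclideanSpace ℝ (Fin 2) × ℝ × ℝ |
      a ≤ ‖w.1‖ ∧ finalDistance t w < b} :=
    (measurableSet_le measurable_const measurable_fst.norm).inter
      (measurableSet_lt (continuous_finalDistance t).measurable measurable_const)
  have hT : MeasurableSet {w : EuclideanSpace ℝ (Fin 2) × ℝ × ℝ |
      a ≤ ‖w.1 - polarVec (w.2.1 * t) w.2.2‖ ∧ ‖w.1‖ < b} :=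
    (measurableSet_le measurable_const (continuous_fst.sub hpc).norm.measurable).inter
      (measurableSet_lt measurable_fst.norm measurable_const)
  have h1 : ν.prod (motionLaw f) {w | a ≤ ‖w.1‖ ∧ finalDistance t w < b}
      = ν.prod (motionLaw f) {w | a ≤ ‖w.1 - polarVec (w.2.1 * t) w.2.2‖ ∧ ‖w.1‖ < b} := by
    rw [Measure.prod_apply_symm hS, Measure.prod_apply_symm hT]
    refine lintegral_congr fun m => ?_
    refine Eq.trans ?_ (measure_preimage_add_right ν (polarVec (m.1 * t) m.2) _)
    congr 1
    ext y
    simp [finalDistance]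
  change ν.prod (motionLaw f) _ = ∫⁻ z in Metric.ball 0 b, _ ∂ν
  rw [h1, Measure.prod_apply hT, ← lintegral_indicator measurableSet_ball]
  refine lintegral_congr fun z => ?_
  by_cases hz : ‖z‖ < b
  · rw [indicator_of_mem (by simpa using hz), ← motionLaw_le_norm_sub_polarVec]
    congr 1
    ext m
    simp [hz]
  · rw [indicator_of_notMem (by simpa using hz)]
    convert! measure_empty (μ := motionLaw f)
    ext m
    simp [hz]

lemma markedIntensity_lt_or_lt (lam0 t a b : ℝ) :
    markedIntensity lam0 f {w | ‖w.1‖ < a ∨ finalDistance t w < b}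
      = (ENNReal.ofReal lam0 • volume : Measure (EuclideanSpace ℝ (Fin 2))) (Metric.ball 0 a)
        + ∫⁻ z in Metric.ball (0 : EuclideanSpace ℝ (Fin 2)) b, farProb f t a ‖z‖
          ∂(ENNReal.ofReal lam0 • volume) := by
  rw [← markedIntensity_norm_lt (f := f), ← markedIntensity_le_norm_finalDistance_lt,
    ← measure_union]
  · congr 1
    ext w
    by_cases h : ‖w.1‖ < a
    · simp [h]
    · simp [h, not_lt.1 h]
  · rw [Set.disjoint_left]
    intro w h1 h2
    exact (not_le.2 h1) h2.1
  · exact (measurableSet_le measurable_const measurable_fst.norm).inter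
      (measurableSet_lt (continuous_finalDistance t).measurable measurable_const)

lemma smul_volume_ball_ne_top (lam0 a : ℝ) :
    (ENNReal.ofReal lam0 • volume : Measure (EuclideanSpace ℝ (Fin 2))) (Metric.ball 0 a) ≠ ⊤ := by
  rw [Measure.smul_apply, smul_eq_mul]
  exact ENNReal.mul_ne_top ENNReal.ofReal_ne_top measure_ball_lt_top.ne

lemma lintegral_farProb_ball_ne_top (lam0 t a b : ℝ) :
    ∫⁻ z in Metric.ball (0 : EuclideanSpace ℝ (Fin 2)) b, farProb f t a ‖z‖
      ∂(ENNReal.ofReal lam0 • volume) ≠ ⊤ := by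
  refine ne_top_of_le_ne_top (smul_volume_ball_ne_top lam0 b) ?_
  refine (lintegral_mono fun z => farProb_le_one t a ‖z‖).trans ?_
  simp

lemma markedIntensity_lt_or_lt_ne_top (lam0 t a b : ℝ) :
    markedIntensity lam0 f {w | ‖w.1‖ < a ∨ finalDistance t w < b} ≠ ⊤ := by
  rw [markedIntensity_lt_or_lt]
  exact ENNReal.add_ne_top.2 ⟨smul_volume_ball_ne_top _ _, lintegral_farProb_ball_ne_top _ _ _ _⟩

lemma toReal_lintegral_farProb_ball {lam0 : ℝ} (hlam0 : 0 ≤ lam0) (t a : ℝ) {b : ℝ} (hb : 0 ≤ b) :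
    (∫⁻ z in Metric.ball (0 : EuclideanSpace ℝ (Fin 2)) b, farProb f t a ‖z‖
      ∂(ENNReal.ofReal lam0 • volume)).toReal
      = ∫ u in (0 : ℝ)..b, 2 * Real.pi * u * (lam0 * (farProb f t a u).toReal) := by
  have hm := measurable_farProb_right (f := f) t a
  have hnn : ∀ u ∈ Ioo 0 b, 0 ≤ 2 * Real.pi * u * (farProb f t a u).toReal := fun u hu => by
    have := hu.1
    positivity
  have hint : ∀ u, 2 * Real.pi * u * (lam0 * (farProb f t a u).toReal)
      = lam0 * (2 * Real.pi * u * (farProb f t a u).toReal) := fun u => by ring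
  simp_rw [hint]
  rw [lintegral_ball_smul_volume lam0 b hm, ENNReal.toReal_mul, ENNReal.toReal_ofReal hlam0,
    intervalIntegral.integral_const_mul, intervalIntegral.integral_of_le hb,
    integral_Ioc_eq_integral_Ioo, integral_eq_lintegral_of_nonneg_ae]
  · congr 2
    refine setLIntegral_congr_fun measurableSet_Ioo fun u hu => ?_
    have := hu.1
    rw [ENNReal.ofReal_mul (p := 2 * Real.pi * u) (by positivity),
      ENNReal.ofReal_toReal (ne_top_of_le_ne_top ENNReal.one_ne_top (farProb_le_one t a u))]
  · exact (ae_restrict_iff' measurableSet_Ioo).2 (ae_of_all _ hnn)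
  · have := hm.ennreal_toReal
    fun_prop

/-- The void probability of the set of the drones that are closer to the origin than `a` at time
`0` or closer than `b` at time `t`. -/
lemma expNeg_markedIntensity {lam0 : ℝ} (hlam0 : 0 ≤ lam0) (t : ℝ) {a b : ℝ} (ha : 0 ≤ a)
    (hb : 0 ≤ b) :
    expNeg (markedIntensity lam0 f {w | ‖w.1‖ < a ∨ finalDistance t w < b})
      = ENNReal.ofReal (Real.exp (-(lam0 * Real.pi * a ^ 2)) *
        Real.exp (-∫ u in (0 : ℝ)..b, 2 * Real.pi * u * (lam0 * (farProb f t a u).toReal))) := by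
  rw [expNeg, markedIntensity_lt_or_lt, ENNReal.toReal_add (smul_volume_ball_ne_top _ _)
    (lintegral_farProb_ball_ne_top _ _ _ _), toReal_lintegral_farProb_ball hlam0 t a hb, neg_add,
    Real.exp_add]
  congr 4
  rw [Measure.smul_apply, EuclideanSpace.volume_ball_fin_two, smul_eq_mul, ENNReal.toReal_mul,
    ENNReal.toReal_ofReal hlam0]
  simp [ENNReal.toReal_ofReal ha, ENNReal.toReal_ofReal Real.pi_pos.le]
  ring

/-- Once the direction is averaged out, the integrand is radial in the starting point. -/
lemma lintegral_markedIntensity (lam0 t : ℝ) {H : ℝ × ℝ → ℝ≥0∞} (hH : Measurable H) :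
    ∫⁻ w, H (‖w.1‖, finalDistance t w) ∂(markedIntensity lam0 f)
      = ENNReal.ofReal lam0 * ∫⁻ v, ∫⁻ u in Ioi 0, ENNReal.ofReal (2 * Real.pi * u) *
          ∫⁻ θ, H (u, displacedDistance t u v θ) ∂uniformAngle ∂volume ∂(densityLaw f) := by
  have hHd : Measurable fun w : EuclideanSpace ℝ (Fin 2) × ℝ × ℝ => H (‖w.1‖, finalDistance t w) :=
    hH.comp ((measurable_norm.comp measurable_fst).prodMk (continuous_finalDistance t).measurable)
  have hHθ : ∀ v, Measurable fun u => ∫⁻ θ, H (u, displacedDistance t u v θ) ∂uniformAngle := by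
    intro v
    refine Measurable.lintegral_prod_right' (f := fun z : ℝ × ℝ =>
      H (z.1, displacedDistance t z.1 v z.2)) ?_
    exact hH.comp (measurable_fst.prodMk ((measurable_displacedDistance t).comp
      (by fun_prop : Measurable fun z : ℝ × ℝ => (z.1, v, z.2))))
  rw [markedIntensity, lintegral_prod_symm _ hHd.aemeasurable, motionLaw,
    lintegral_prod _ (Measurable.lintegral_prod_left' hHd).aemeasurable,
    ← lintegral_const_mul']
  · refine lintegral_congr fun v => ?_
    rw [lintegral_lintegral_swap]
    · simp_rw [finalDistance]
      rw [lintegral_smul_measure, smul_eq_mul, ← lintegral_fun_norm_euclideanPlane (hHθ v)]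
      congr 1
      refine lintegral_congr fun x => ?_
      exact lintegral_uniformAngle_norm_add_polarVec_mul (fun y => H (‖x‖, y)) x v t
    · exact (hHd.comp (by fun_prop : Measurable
        fun p : ℝ × EuclideanSpace ℝ (Fin 2) => (p.2, v, p.1))).aemeasurable
  · exact ENNReal.ofReal_ne_top

end Law

/-! ### Identification of `nonServingDensity`. -/

lemma displacedDistance_lt_iff {t a u v : ℝ} (ht : 0 < t) (ha : 0 < a) (hu : 0 < u) (hv : 0 < v)
    (θ : ℝ) : displacedDistance t u v θ < a ↔
      (v ^ 2 * t ^ 2 + u ^ 2 - a ^ 2) / (2 * v * t * u) < Real.cos θ := by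
  rw [displacedDistance, Real.sqrt_lt' ha, div_lt_iff₀ (by positivity)]
  constructor <;> intro h <;> nlinarith

lemma uniformAngle_displacedDistance_lt {t a u v : ℝ} (ht : 0 < t) (ha : 0 < a) (hu : 0 < u)
    (hv : 0 < v) : uniformAngle {θ | displacedDistance t u v θ < a}
      = ENNReal.ofReal
        (Real.arccos ((v ^ 2 * t ^ 2 + u ^ 2 - a ^ 2) / (2 * v * t * u)) / Real.pi) := by
  simp_rw [displacedDistance_lt_iff ht ha hu hv]
  exact uniformAngle_lt_cos _

section Law

variable {f : ℝ → ℝ} [IsProbabilityMeasure (densityLaw f)]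

lemma toReal_farProb {t a u : ℝ} (ht : 0 < t) (ha : 0 < a) (hu : 0 < u)
    (hpos : ∀ᵐ v ∂densityLaw f, 0 < v) :
    (farProb f t a u).toReal = 1 - ∫ v, Real.arccos ((v ^ 2 * t ^ 2 + u ^ 2 - a ^ 2) /
      (2 * v * t * u)) / Real.pi ∂densityLaw f := by
  have hS : MeasurableSet {m : ℝ × ℝ | displacedDistance t u m.1 m.2 < a} :=
    measurableSet_lt ((measurable_displacedDistance t).comp measurable_prodMk_left)
      measurable_const
  have hfar : farProb f t a u = motionLaw f {m | displacedDistance t u m.1 m.2 < a}ᶜ := by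
    rw [farProb]; congr 1; ext m; simp
  have hmeas : Measurable fun v : ℝ => Real.arccos ((v ^ 2 * t ^ 2 + u ^ 2 - a ^ 2) /
      (2 * v * t * u)) / Real.pi :=
    (Real.continuous_arccos.measurable.comp (by fun_prop)).div_const _
  rw [hfar, ← measureReal_def, probReal_compl_eq_one_sub hS,
    integral_eq_lintegral_of_nonneg_ae
      (ae_of_all _ fun v => div_nonneg (Real.arccos_nonneg _) Real.pi_pos.le)
      hmeas.aestronglyMeasurable, measureReal_def, motionLaw, Measure.prod_apply hS]
  congr 2
  refine lintegral_congr_ae ?_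
  filter_upwards [hpos] with v hv
  exact uniformAngle_displacedDistance_lt ht ha hu hv

/-- The chance of ending within `a` is the mean over speeds of `arccos (…) / π`. Outside the range
of speeds allowed by the triangle inequality, `arccos` is clamped: slow drones with `u < a`
contribute `1`, hence the cdf term, and all others `0`. -/
lemma nonServingDensity_eq {lam0 t a u : ℝ} (hf : Measurable f) (hf0 : ∀ v, 0 ≤ f v)
    (ht : 0 < t) (ha : 0 < a) (hu : 0 < u) (hpos : ∀ᵐ v ∂densityLaw f, 0 < v) :
    nonServingDensity lam0 f t u a = lam0 * (farProb f t a u).toReal := by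
  let g : ℝ → ℝ := fun v =>
    Real.arccos ((v ^ 2 * t ^ 2 + u ^ 2 - a ^ 2) / (2 * v * t * u)) / Real.pi
  have hmeas : Measurable g :=
    (Real.continuous_arccos.measurable.comp (by fun_prop)).div_const _
  have hg : Integrable g (densityLaw f) := by
    refine Integrable.of_bound hmeas.aestronglyMeasurable 1 (ae_of_all _ fun v => ?_)
    rw [Real.norm_of_nonneg (div_nonneg (Real.arccos_nonneg _) Real.pi_pos.le)]
    exact (div_le_one Real.pi_pos).2 (Real.arccos_le_pi _)
  have hA0 : 0 ≤ |a - u| / t := by positivity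
  have hAB : |a - u| / t ≤ (a + u) / t := by
    gcongr
    exact abs_le.2 ⟨by linarith, by linarith⟩
  have hmid : ∫ v in Ioc (|a - u| / t) ((a + u) / t), g v ∂densityLaw f
      = ∫ v in (|a - u| / t)..((a + u) / t), f v * (1 / Real.pi) *
        Real.arccos ((v ^ 2 * t ^ 2 + u ^ 2 - a ^ 2) / (2 * v * t * u)) := by
    rw [intervalIntegral.integral_of_le hAB, densityLaw,
      setIntegral_withDensity_eq_setIntegral_toReal_smul (by fun_prop)
        (ae_of_all _ fun _ => ENNReal.ofReal_lt_top) _ measurableSet_Ioc]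
    refine integral_congr_ae (ae_of_all _ fun v => ?_)
    simp only [ENNReal.toReal_ofReal (hf0 v), smul_eq_mul, g]
    ring
  -- A displacement differing from `u` by at least `a` cannot end strictly within `a`; the cosine
  -- threshold is then at least `1`.
  have hone : ∀ v, 0 < v → a ≤ |v * t - u| → g v = 0 := by
    intro v hv h
    have h2 : a ^ 2 ≤ (v * t - u) ^ 2 := by
      rw [← sq_abs (v * t - u)]
      gcongr
    simp only [g]
    rw [Real.arccos_of_one_le, zero_div]
    rw [le_div_iff₀ (by positivity)]
    nlinarith
  have hlow : ∫ v in Iic (|a - u| / t), g v ∂densityLaw f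
      = cdf (densityLaw f) ((a - u) / t) := by
    rw [cdf_eq_real]
    rcases lt_or_ge u a with h | h
    · rw [abs_of_pos (sub_pos.2 h)]
      have : ∀ᵐ v ∂densityLaw f, v ∈ Iic ((a - u) / t) → g v = 1 := by
        filter_upwards [hpos] with v hv hvA
        have hvt : v * t ≤ a - u := (le_div_iff₀ ht).1 hvA
        simp only [g]
        rw [Real.arccos_of_le_neg_one, div_self Real.pi_pos.ne']
        rw [div_le_iff₀ (by positivity)]
        have h0 : 0 < v * t := by positivity
        nlinarith [mul_self_le_mul_self (by linarith : 0 ≤ v * t + u) (by linarith : v * t + u ≤ a)]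
      rw [setIntegral_congr_ae measurableSet_Iic this]
      simp
    · have h1 : ∀ᵐ v ∂densityLaw f, v ∈ Iic (|a - u| / t) → g v = 0 := by
        filter_upwards [hpos] with v hv hvA
        refine hone v hv ?_
        have hvt : v * t ≤ |a - u| := (le_div_iff₀ ht).1 hvA
        rw [abs_of_nonpos (by linarith)] at hvt
        rw [abs_sub_comm]
        exact le_trans (by linarith) (le_abs_self _)
      rw [setIntegral_congr_ae measurableSet_Iic h1]
      have h2 : densityLaw f (Iic ((a - u) / t)) = 0 := by
        have h3 : densityLaw f {v | ¬ 0 < v} = 0 := hpos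
        refine measure_mono_null (fun v hv => ?_) h3
        exact not_lt.2 (le_trans hv (div_nonpos_of_nonpos_of_nonneg (by linarith) ht.le))
      simp [measureReal_def, h2]
  have hhigh : ∫ v in Ioi ((a + u) / t), g v ∂densityLaw f = 0 := by
    rw [setIntegral_congr_fun (g := fun _ => (0 : ℝ)) measurableSet_Ioi]
    · simp
    · intro v hv
      have hvt : a + u < v * t := (div_lt_iff₀ ht).1 hv
      refine hone v (lt_of_le_of_lt (by positivity) hv) ?_
      exact le_trans (by linarith) (le_abs_self _)
  have hsplit : ∫ v, g v ∂densityLaw f = cdf (densityLaw f) ((a - u) / t) +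
      ∫ v in (|a - u| / t)..((a + u) / t), f v * (1 / Real.pi) *
        Real.arccos ((v ^ 2 * t ^ 2 + u ^ 2 - a ^ 2) / (2 * v * t * u)) := by
    rw [← integral_add_compl (measurableSet_Iic (a := (a + u) / t)) hg, compl_Iic, hhigh,
      ← Iic_union_Ioc_eq_Iic hAB, setIntegral_union (Iic_disjoint_Ioc le_rfl) measurableSet_Ioc
        hg.integrableOn hg.integrableOn, hlow, hmid, add_zero]
  rw [toReal_farProb ht ha hu hpos, hsplit, nonServingDensity]
  ring

end Law

/-! ### The bound as a triple integral. -/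

lemma norm_dronePosition_le_iff (h s : ℝ) (x y : EuclideanSpace ℝ (Fin 2)) (v θ w η : ℝ) :
    ‖dronePosition h x v θ s‖ ≤ ‖dronePosition h y w η s‖ ↔
      finalDistance s (x, v, θ) ≤ finalDistance s (y, w, η) := by
  rw [norm_dronePosition, norm_dronePosition]
  simp only [finalDistance, EuclideanSpace.norm_eq, Fin.sum_univ_two]
  rw [Real.sqrt_le_sqrt_iff (by positivity), Real.sqrt_le_sqrt_iff (by positivity)]
  simp [polarVec]

lemma finalDistance_zero (w : EuclideanSpace ℝ (Fin 2) × ℝ × ℝ) : finalDistance 0 w = ‖w.1‖ := by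
  rw [finalDistance]
  congr 1
  ext i
  fin_cases i <;> simp [polarVec]

lemma displacedDistance_nonneg (t u v θ : ℝ) : 0 ≤ displacedDistance t u v θ :=
  Real.sqrt_nonneg _

section Law

variable {f : ℝ → ℝ} [IsProbabilityMeasure (densityLaw f)]

/-- The probability that all drones other than the serving one are farther than `a` at time `0` and
farther than `b` at time `t`. -/
noncomputable def noCloserProb (lam0 : ℝ) (f : ℝ → ℝ) (t : ℝ) (z : ℝ × ℝ) : ℝ≥0∞ :=
  expNeg (markedIntensity lam0 f {w | ‖w.1‖ < z.1 ∨ finalDistance t w < z.2})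

lemma measurable_noCloserProb (lam0 t : ℝ) : Measurable (noCloserProb lam0 f t) :=
  measurable_expNeg.comp
    (measurable_measure_lt_or_lt measurable_fst.norm (continuous_finalDistance t).measurable)

omit [IsProbabilityMeasure (densityLaw f)] in
lemma noCloserProb_le_one (lam0 t : ℝ) (z : ℝ × ℝ) : noCloserProb lam0 f t z ≤ 1 :=
  expNeg_le_one _

/-- The mean over the direction of the probability that the initially serving drone, with initial
distance `u` and speed `v`, is serving at time `t`. -/
noncomputable def stayProb (lam0 : ℝ) (f : ℝ → ℝ) (t v u : ℝ) : ℝ≥0∞ :=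
  ∫⁻ θ, noCloserProb lam0 f t (u, displacedDistance t u v θ) ∂uniformAngle

lemma measurable_noCloserProb_displacedDistance (lam0 t : ℝ) :
    Measurable fun z : (ℝ × ℝ) × ℝ =>
      noCloserProb lam0 f t (z.1.2, displacedDistance t z.1.2 z.1.1 z.2) :=
  (measurable_noCloserProb lam0 t).comp ((measurable_snd.comp measurable_fst).prodMk
    ((measurable_displacedDistance t).comp
      (by fun_prop : Measurable fun z : (ℝ × ℝ) × ℝ => (z.1.2, z.1.1, z.2))))

lemma measurable_stayProb (lam0 t : ℝ) :
    Measurable fun z : ℝ × ℝ => stayProb lam0 f t z.1 z.2 :=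
  (measurable_noCloserProb_displacedDistance lam0 t).lintegral_prod_right'

omit [IsProbabilityMeasure (densityLaw f)] in
lemma stayProb_le_one (lam0 t v u : ℝ) : stayProb lam0 f t v u ≤ 1 :=
  (lintegral_mono fun _ => noCloserProb_le_one _ _ _).trans (by simp)

lemma toReal_noCloserProb {lam0 t a b : ℝ} (hlam0 : 0 ≤ lam0) (hf : Measurable f)
    (hf0 : ∀ v, 0 ≤ f v) (ht : 0 < t) (ha : 0 < a) (hb : 0 ≤ b)
    (hpos : ∀ᵐ v ∂densityLaw f, 0 < v) :
    (noCloserProb lam0 f t (a, b)).toReal = Real.exp (-(lam0 * Real.pi * a ^ 2)) *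
      Real.exp (-∫ u in (0 : ℝ)..b, 2 * Real.pi * u * nonServingDensity lam0 f t u a) := by
  rw [noCloserProb, expNeg_markedIntensity hlam0 t ha.le hb, ENNReal.toReal_ofReal (by positivity)]
  congr 3
  rw [intervalIntegral.integral_of_le hb, intervalIntegral.integral_of_le hb]
  refine setIntegral_congr_fun measurableSet_Ioc fun u hu => ?_
  simp only [nonServingDensity_eq hf hf0 ht ha hu.1 hpos]

lemma noCloserProb_le {lam0 : ℝ} (hlam0 : 0 ≤ lam0) (t : ℝ) {a : ℝ} (ha : 0 ≤ a) {b : ℝ}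
    (hb : 0 ≤ b) :
    noCloserProb lam0 f t (a, b) ≤ ENNReal.ofReal (Real.exp (-(lam0 * Real.pi * a ^ 2))) := by
  rw [noCloserProb, expNeg_markedIntensity hlam0 t ha hb]
  refine ENNReal.ofReal_le_ofReal (mul_le_of_le_one_right (by positivity) ?_)
  rw [Real.exp_le_one_iff, neg_nonpos]
  refine intervalIntegral.integral_nonneg hb fun u hu => ?_
  have := hu.1
  positivity

/-- The empty disc at time `0` alone gives a Gaussian bound uniform in `v`. It supplies the
finiteness needed to pass from `lintegral` to Bochner integrals. -/
lemma exists_lintegral_stayProb_le {lam0 : ℝ} (hlam0 : 0 < lam0) (t : ℝ) :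
    ∃ C : ℝ≥0∞, C ≠ ⊤ ∧ ∀ v, ∫⁻ u in Ioi (0 : ℝ),
      ENNReal.ofReal (2 * Real.pi * u) * stayProb lam0 f t v u ≤ C := by
  refine ⟨∫⁻ u in Ioi (0 : ℝ), ENNReal.ofReal
    (2 * Real.pi * (u * Real.exp (-(lam0 * Real.pi) * u ^ 2))), ?_, fun v => ?_⟩
  · have h := ((integrable_mul_exp_neg_mul_sq (b := lam0 * Real.pi) (by positivity)).const_mul
      (2 * Real.pi)).integrableOn (s := Ioi 0)
    exact (h.lintegral_lt_top).ne
  · refine setLIntegral_mono' measurableSet_Ioi fun u hu => ?_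
    have hu0 : (0 : ℝ) < u := hu
    have h1 : stayProb lam0 f t v u ≤ ENNReal.ofReal (Real.exp (-(lam0 * Real.pi * u ^ 2))) := by
      refine (lintegral_mono fun θ =>
        noCloserProb_le hlam0.le t hu0.le (displacedDistance_nonneg _ _ _ _)).trans ?_
      simp
    refine (mul_le_mul_right h1 _).trans ?_
    rw [← ENNReal.ofReal_mul (by positivity), mul_assoc (2 * Real.pi) u, neg_mul]

/-- The integral of the void probability over all possible serving drones, in the
coordinates of the theorem. -/
lemma toReal_lintegral_noCloserProb {lam0 t : ℝ} (hlam0 : 0 < lam0) (ht : 0 < t)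
    (hf : Measurable f) (hf0 : ∀ v, 0 ≤ f v) (hpos : ∀ᵐ v ∂densityLaw f, 0 < v) :
    ∫⁻ w, noCloserProb lam0 f t (‖w.1‖, finalDistance t w) ∂markedIntensity lam0 f ≠ ⊤ ∧
    (∫⁻ w, noCloserProb lam0 f t (‖w.1‖, finalDistance t w) ∂markedIntensity lam0 f).toReal
      = 1 / (2 * Real.pi) *
        (∫ v in Set.Ioi (0 : ℝ), ∫ ustar in Set.Ioi (0 : ℝ), ∫ θ in (0 : ℝ)..(2 * Real.pi),
          2 * Real.pi * lam0 * ustar * Real.exp (-(lam0 * Real.pi * ustar ^ 2)) * f v *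
            Real.exp (-∫ u in (0 : ℝ)..(displacedDistance t ustar v θ),
              2 * Real.pi * u * nonServingDensity lam0 f t u ustar)) := by
  let k : ℝ → ℝ≥0∞ := fun v => ∫⁻ u in Ioi (0 : ℝ),
    ENNReal.ofReal (2 * Real.pi * u) * stayProb lam0 f t v u
  have hsm := measurable_stayProb (f := f) lam0 t
  have hkm : Measurable k := by
    refine Measurable.lintegral_prod_right' (f := fun z : ℝ × ℝ =>
      ENNReal.ofReal (2 * Real.pi * z.2) * stayProb lam0 f t z.1 z.2) ?_
    exact (by fun_prop : Measurable fun z : ℝ × ℝ => ENNReal.ofReal (2 * Real.pi * z.2)).mul hsm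
  obtain ⟨C, hC, hkC⟩ := exists_lintegral_stayProb_le (f := f) hlam0 t
  have hI : ∫⁻ w, noCloserProb lam0 f t (‖w.1‖, finalDistance t w) ∂markedIntensity lam0 f
      = ENNReal.ofReal lam0 * ∫⁻ v, k v ∂densityLaw f :=
    lintegral_markedIntensity lam0 t (measurable_noCloserProb lam0 t)
  have hkI : ∫⁻ v, k v ∂densityLaw f ≠ ⊤ := by
    refine ne_top_of_le_ne_top hC ((lintegral_mono hkC).trans ?_)
    simp
  refine ⟨by rw [hI]; exact ENNReal.mul_ne_top ENNReal.ofReal_ne_top hkI, ?_⟩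
  -- The Bochner integrals are converted from the inside out; normalising the angle absorbs the
  -- factor `2 * π`.
  have hθ : ∀ v u, 0 < u → ∫ θ in (0 : ℝ)..(2 * Real.pi),
      2 * Real.pi * lam0 * u * Real.exp (-(lam0 * Real.pi * u ^ 2)) * f v *
        Real.exp (-∫ x in (0 : ℝ)..(displacedDistance t u v θ),
          2 * Real.pi * x * nonServingDensity lam0 f t x u)
      = (2 * Real.pi * lam0 * f v) *
        (ENNReal.ofReal (2 * Real.pi * u) * stayProb lam0 f t v u).toReal := by
    intro v u hu
    have hm : Measurable fun θ => noCloserProb lam0 f t (u, displacedDistance t u v θ) :=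
      (measurable_noCloserProb (f := f) lam0 t).comp (measurable_const.prodMk
        ((measurable_displacedDistance t).comp
          (by fun_prop : Measurable fun θ : ℝ => (u, v, θ))))
    have h1 : ∀ θ, 2 * Real.pi * lam0 * u * Real.exp (-(lam0 * Real.pi * u ^ 2)) * f v *
        Real.exp (-∫ x in (0 : ℝ)..(displacedDistance t u v θ),
          2 * Real.pi * x * nonServingDensity lam0 f t x u)
        = (2 * Real.pi * lam0 * u * f v) *
          (noCloserProb lam0 f t (u, displacedDistance t u v θ)).toReal := by
      intro θ
      rw [toReal_noCloserProb hlam0.le hf hf0 ht hu (displacedDistance_nonneg _ _ _ _) hpos]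
      ring
    simp_rw [h1]
    rw [intervalIntegral.integral_const_mul, intervalIntegral.integral_of_le Real.two_pi_pos.le,
      integral_toReal hm.aemeasurable
        (ae_of_all _ fun θ => (noCloserProb_le_one _ _ _).trans_lt ENNReal.one_lt_top),
      stayProb, lintegral_uniformAngle, setLIntegral_congr Ico_ae_eq_Ioc]
    simp only [ENNReal.toReal_mul, ENNReal.toReal_inv]
    rw [ENNReal.toReal_ofReal (by positivity), ENNReal.toReal_ofReal (by positivity)]
    field_simp
  have hu : ∀ v, ∫ u in Ioi (0 : ℝ), ∫ θ in (0 : ℝ)..(2 * Real.pi),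
      2 * Real.pi * lam0 * u * Real.exp (-(lam0 * Real.pi * u ^ 2)) * f v *
        Real.exp (-∫ x in (0 : ℝ)..(displacedDistance t u v θ),
          2 * Real.pi * x * nonServingDensity lam0 f t x u)
      = (2 * Real.pi * lam0) * (ENNReal.ofReal (f v) * k v).toReal := by
    intro v
    rw [setIntegral_congr_fun measurableSet_Ioi fun u hu => hθ v u hu, integral_const_mul,
      integral_toReal, ENNReal.toReal_mul, ENNReal.toReal_ofReal (hf0 v)]
    · ring
    · exact ((by fun_prop : Measurable fun u : ℝ => ENNReal.ofReal (2 * Real.pi * u)).mul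
        (hsm.comp measurable_prodMk_left)).aemeasurable
    · exact ae_of_all _ fun u => ENNReal.mul_lt_top ENNReal.ofReal_lt_top
        ((stayProb_le_one _ _ _ _).trans_lt ENNReal.one_lt_top)
  have hv : ∫⁻ v, k v ∂densityLaw f = ∫⁻ v in Ioi (0 : ℝ), ENNReal.ofReal (f v) * k v := by
    -- Speeds are almost surely positive, so restricting the law changes nothing.
    have hres : (densityLaw f).restrict (Ioi 0) = densityLaw f :=
      Measure.restrict_eq_self_of_ae_mem hpos
    rw [← hres, densityLaw, setLIntegral_withDensity_eq_setLIntegral_mul _ (by fun_prop) hkm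
      measurableSet_Ioi]
    rfl
  simp_rw [hu]
  rw [integral_const_mul, integral_toReal, ← hv, hI, ENNReal.toReal_mul,
    ENNReal.toReal_ofReal hlam0.le]
  · field_simp
  · exact (hf.ennreal_ofReal.mul hkm).aemeasurable
  · exact ae_of_all _ fun v => ENNReal.mul_lt_top ENNReal.ofReal_lt_top
      ((hkC v).trans_lt hC.lt_top)

end Law

/-! ### Application to the drone model. -/

namespace IsDifferentSpeedModel

variable {Ω : Type*} [MeasurableSpace Ω] {μ : Measure Ω} [IsProbabilityMeasure μ]
  {lam0 : ℝ} {f : ℝ → ℝ} {X : ℕ → Ω → EuclideanSpace ℝ (Fin 2)} {V Θ : ℕ → Ω → ℝ}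

lemma isProbabilityMeasure_densityLaw (hm : IsDifferentSpeedModel μ lam0 f X V Θ) :
    IsProbabilityMeasure (densityLaw f) := by
  rw [← hm.speed_law 0]
  exact Measure.isProbabilityMeasure_map (hm.speed_measurable 0).aemeasurable

omit [IsProbabilityMeasure μ] in
-- A law with a density has no atom at `0`.
lemma ae_pos (hm : IsDifferentSpeedModel μ lam0 f X V Θ) : ∀ᵐ v ∂densityLaw f, 0 < v := by
  have h1 : ∀ᵐ v ∂densityLaw f, 0 ≤ v := by
    rw [← hm.speed_law 0, ae_map_iff (hm.speed_measurable 0).aemeasurable measurableSet_Ici]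
    exact hm.speed_nonneg 0
  have h2 : ∀ᵐ v ∂densityLaw f, v ≠ 0 :=
    (withDensity_absolutelyContinuous _ _).ae_le (by simp [ae_iff] : ∀ᵐ v : ℝ, v ≠ 0)
  filter_upwards [h1, h2] with v h1 h2
  exact lt_of_le_of_ne h1 h2.symm

lemma motion_law (hm : IsDifferentSpeedModel μ lam0 f X V Θ) (i : ℕ) :
    μ.map (fun ω => (V i ω, Θ i ω)) = motionLaw f := by
  rw [(indepFun_iff_map_prod_eq_prod_map_map (hm.speed_measurable i).aemeasurable
    (hm.direction_measurable i).aemeasurable).1 (hm.speed_indep_direction i), hm.speed_law i,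
    hm.direction_law i]
  rfl

/-- Without a handover, one and the same drone is closest at time `0` and at time `t`. -/
lemma ae_exists_closest_of_notMem_handoverEvent (hm : IsDifferentSpeedModel μ lam0 f X V Θ)
    (h : ℝ) {t : ℝ} (ht : 0 < t) :
    ∀ᵐ ω ∂μ, ω ∉ handoverEvent h X V Θ t → ∃ i, ∀ j, ‖X i ω‖ ≤ ‖X j ω‖ ∧
      finalDistance t (X i ω, V i ω, Θ i ω) ≤ finalDistance t (X j ω, V j ω, Θ j ω) := by
  -- Existence of a minimiser is essential: two empty argmin sets would also count as no handover.
  -- Uniqueness is not needed.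
  filter_upwards [hm.start_poisson.ae_exists_forall_norm_le
    fun m => smul_volume_ball_ne_top lam0 m] with ω hω hnot
  obtain ⟨i, hi⟩ := hω
  have heq : servingDrone h X V Θ 0 ω = servingDrone h X V Θ t ω := by
    by_contra hne
    exact hnot ⟨0, le_rfl, ht, hne⟩
  have h0 : i ∈ servingDrone h X V Θ 0 ω := fun j => by
    rw [norm_dronePosition_le_iff, finalDistance_zero, finalDistance_zero]
    exact hi j
  have h1 : i ∈ servingDrone h X V Θ t ω := heq ▸ h0
  exact ⟨i, fun j => ⟨hi j, (norm_dronePosition_le_iff _ _ _ _ _ _ _ _).1 (h1 j)⟩⟩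

lemma measure_compl_handoverEvent_le (hm : IsDifferentSpeedModel μ lam0 f X V Θ)
    (h : ℝ) {t : ℝ} (ht : 0 < t) :
    μ (handoverEvent h X V Θ t)ᶜ
      ≤ ∫⁻ w, noCloserProb lam0 f t (‖w.1‖, finalDistance t w) ∂markedIntensity lam0 f := by
  have := hm.isProbabilityMeasure_densityLaw
  have hMm : ∀ i, Measurable fun ω => (V i ω, Θ i ω) := fun i =>
    (hm.speed_measurable i).prodMk (hm.direction_measurable i)
  refine (measure_mono_ae ?_).trans (measure_exists_argmin_le
    (Z := fun i ω => (X i ω, V i ω, Θ i ω)) (N := markedIntensity lam0 f)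
    (r := fun w => ‖w.1‖) (R := finalDistance t)
    (fun i => (hm.start_poisson.measurable i).prodMk (hMm i)) (fun G hG hfin => ?_)
    measurable_fst.norm (continuous_finalDistance t).measurable (fun _ => norm_nonneg _)
    (fun _ => norm_nonneg _) fun a b => markedIntensity_lt_or_lt_ne_top lam0 t a b)
  · exact hm.ae_exists_closest_of_notMem_handoverEvent h ht
  · exact hm.start_poisson.measure_forall_notMem hMm hm.motion_law hm.motion_indep
      hm.start_indep_motion hG hfin

end IsDifferentSpeedModel

theorem theorem3 {Ω : Type*} [MeasurableSpace Ω] (μ : Measure Ω) [IsProbabilityMeasure μ]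
    (h lam0 t : ℝ) (hlam0 : 0 < lam0) (ht : 0 < t)
    (f : ℝ → ℝ) (hf_meas : Measurable f) (hf_nonneg : ∀ v, 0 ≤ f v)
    (X : ℕ → Ω → EuclideanSpace ℝ (Fin 2)) (V Θ : ℕ → Ω → ℝ)
    (hmodel : IsDifferentSpeedModel μ lam0 f X V Θ) :
    NullMeasurableSet (handoverEvent h X V Θ t) μ ∧
    1 - 1 / (2 * Real.pi) *
        (∫ v in Set.Ioi (0 : ℝ), ∫ ustar in Set.Ioi (0 : ℝ), ∫ θ in (0 : ℝ)..(2 * Real.pi),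
          2 * Real.pi * lam0 * ustar * Real.exp (-(lam0 * Real.pi * ustar ^ 2)) * f v *
            Real.exp (-∫ u in (0 : ℝ)..(displacedDistance t ustar v θ),
              2 * Real.pi * u * nonServingDensity lam0 f t u ustar))
      ≤ μ.real (handoverEvent h X V Θ t) := by
  have hmeas : MeasurableSet (handoverEvent h X V Θ t) :=
    measurableSet_handoverEvent h t hmodel.start_poisson.measurable hmodel.speed_measurable
      hmodel.direction_measurable
  have := hmodel.isProbabilityMeasure_densityLaw
  obtain ⟨hfin, heq⟩ := toReal_lintegral_noCloserProb hlam0 ht hf_meas hf_nonneg hmodel.ae_pos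
  refine ⟨hmeas.nullMeasurableSet, ?_⟩
  have hle : μ.real (handoverEvent h X V Θ t)ᶜ ≤ _ :=
    ENNReal.toReal_mono hfin (hmodel.measure_compl_handoverEvent_le h ht)
  rw [heq, probReal_compl_eq_one_sub hmeas] at hle
  linarith
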